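/- A group $G$ is called left-orderable if it is non-trivial and carries a strict total order $<$ such that $g>h$ implies $fg>fh$ for all $f,g,h\in G$. Let $K$ be a tame knot in a closed, connected (topological) $3$-manifold $M$, with a tubular neighbourhood homeomorphic to a solid torus. On the boundary torus of this neighbourhood let a meridian $\mu$ (a curve bounding a disk in the neighbourhood) and a longitude $\lambda$ (a curve parallel to $K$) be oriented simple closed curves meeting in exactly one point. Joining that point to the base point by one fixed path in $M-K$, regard $\mu$ and $\lambda$ as elements of the knot group $\pi_1(M-K)$. Suppose that the knot group has a presentation \[ \langle a,b \mid (w_1a^mw_1^{-1})\,b^{-r}\,(w_2^{-1}a^nw_2)\,b^{r-k}\rangle , \] where $w_1,w_2$ are arbitrary words in $a^{\pm1},b^{\pm1}$, $m,n,k\ge 0$ and $r$ are integers, and $m,n$ are not both zero. Suppose further that $a$ represents the meridian $\mu$ and that $a^{-s}wa^{-t}$ represents the longitude $\lambda$, where $s,t\in\mathbb Z$ and $w$ is a word in $a$ and $b$ which contains neither $a^{-1}$ nor $b^{-1}$ and contains at least one $b$. Let $p,q$ be coprime integers with $q\neq 0$ and $p/q\ge s+t$. Remove the open tubular neighbourhood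 of $K$ from $M$ and glue in a solid torus by a homeomorphism of the boundary tori that identifies a meridian of the solid torus with a curve of slope $p/q$, that is, a curve homotopic on the torus to one running $p$ times along $\mu$ and $q$ times along $\lambda$. Then the resulting space is a closed, connected $3$-manifold whose fundamental group is not left-orderable. -/

import Mathlib

open Set

noncomputable section

/-- A group is left-orderable if it is non-trivial and carries a strict total order which is
invariant under left multiplication. -/
def IsLeftOrderable (G : Type*) [Group G] : Prop :=
  Nontrivial G ∧ ∃ _ : LinearOrder G, ∀ f g h : G, g > h → f * g > f * h

/-- A closed (compact, without boundary) topological 3-manifold: Hausdorff, second countable,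
compact and locally homeomorphic to `ℝ³`. -/
def IsClosedThreeManifold (X : Type*) [TopologicalSpace X] : Prop :=
  T2Space X ∧ SecondCountableTopology X ∧ CompactSpace X ∧
    Nonempty (ChartedSpace (EuclideanSpace ℝ (Fin 3)) X)

/-- A (tame) knot `K` in `M` with a parametrised tubular neighbourhood: an open embedding of
`S¹ × ℂ` whose core curve `S¹ × {0}` is `K`. The regular neighbourhood of `K` is the image of
`S¹ × {|z| ≤ 1}` and the peripheral torus is the image of `S¹ × S¹`. Changing the parametrisation by
`(u, z) ↦ (u, u ^ j * z)` and by complex conjugation in either factor realises every longitude of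
`K` and every choice of orientations of meridian and longitude. -/
structure TubularKnot {M : Type*} [TopologicalSpace M] (K : Set M) where
  /-- the parametrisation of the tubular neighbourhood -/
  toFun : Circle × ℂ → M
  isOpenEmbedding : Topology.IsOpenEmbedding toFun
  range_core : range (fun u : Circle => toFun (u, 0)) = K

namespace TubularKnot

variable {M : Type*} [TopologicalSpace M] {K : Set M} (N : TubularKnot K)

theorem toFun_mem_compl (u v : Circle) : N.toFun (u, (v : ℂ)) ∈ Kᶜ := by
  intro hK
  have hK' : N.toFun (u, (v : ℂ)) ∈ range (fun u : Circle => N.toFun (u, 0)) := by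
    rwa [N.range_core]
  obtain ⟨u', hu'⟩ := hK'
  have h := congrArg Prod.snd (N.isOpenEmbedding.injective hu')
  exact v.coe_ne_zero h.symm

/-- The parametrisation of the peripheral torus, as a map to the complement of the knot. The curves
`{u} × S¹` are meridians and the curves `S¹ × {v}` are longitudes. -/
def torus : C(Circle × Circle, ↥Kᶜ) where
  toFun z := ⟨N.toFun (z.1, (z.2 : ℂ)), N.toFun_mem_compl z.1 z.2⟩
  continuous_toFun := by
    refine Continuous.subtype_mk (N.isOpenEmbedding.continuous.comp ?_) _
    fun_prop

/-- The loop `θ ↦ exp (2πiθ)`, `0 ≤ θ ≤ 1`, on the unit circle. -/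
def circleLoop : Path (1 : Circle) 1 where
  toFun θ := Circle.exp (2 * Real.pi * (θ : ℝ))
  continuous_toFun := by fun_prop
  source' := by simp
  target' := by simp

/-- The meridian loop on the peripheral torus. -/
def meridianLoop : Path (N.torus (1, 1)) (N.torus (1, 1)) :=
  ((Path.refl (1 : Circle)).prod circleLoop).map N.torus.continuous

/-- The longitude loop on the peripheral torus. -/
def longitudeLoop : Path (N.torus (1, 1)) (N.torus (1, 1)) :=
  (circleLoop.prod (Path.refl (1 : Circle))).map N.torus.continuous

/-- The element of the knot group given by the meridian, joined to the base point by `γ`. -/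
def meridian {x₀ : ↥Kᶜ} (γ : Path x₀ (N.torus (1, 1))) : FundamentalGroup (↥Kᶜ) x₀ :=
  FundamentalGroup.fromPath (Path.Homotopic.Quotient.mk (γ.trans (N.meridianLoop.trans γ.symm)))

/-- The element of the knot group given by the longitude, joined to the base point by the same
path `γ`. -/
def longitude {x₀ : ↥Kᶜ} (γ : Path x₀ (N.torus (1, 1))) : FundamentalGroup (↥Kᶜ) x₀ :=
  FundamentalGroup.fromPath (Path.Homotopic.Quotient.mk (γ.trans (N.longitudeLoop.trans γ.symm)))

/-- The exterior of the knot: the complement of the open regular neighbourhood. -/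
abbrev Exterior : Type _ :=
  ↥(N.toFun '' ((univ : Set Circle) ×ˢ Metric.ball (0 : ℂ) 1))ᶜ

/-- The closed solid torus `S¹ × D²`; its meridians are the curves `{u} × ∂D²`. -/
abbrev SolidTorus : Type :=
  Circle × ↥(Metric.closedBall (0 : ℂ) 1)

/-- Identify the boundary point `z` of the solid torus with the point of the peripheral torus that
has the coordinates `h z`. -/
def glueRel (h : (Circle × Circle) ≃ₜ (Circle × Circle)) :
    N.Exterior ⊕ SolidTorus → N.Exterior ⊕ SolidTorus → Prop
  | Sum.inl x, Sum.inr y => ∃ z : Circle × Circle,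
      (x : M) = N.toFun ((h z).1, ((h z).2 : ℂ)) ∧ y.1 = z.1 ∧ (y.2 : ℂ) = (z.2 : ℂ)
  | _, _ => False

/-- The result of Dehn surgery: the exterior and a solid torus, glued along their boundary tori by
the homeomorphism `h`, with the quotient topology. -/
abbrev Surgery (h : (Circle × Circle) ≃ₜ (Circle × Circle)) : Type _ :=
  Quot (N.glueRel h)

end TubularKnot

/-- The gluing homeomorphism `h` identifies the meridian `{1} × S¹` of the attached solid torus with
a curve of slope `p/q`, that is (up to homotopy on the peripheral torus) the curve that runs `p`
times along the meridian and `q` times along the longitude of the knot. -/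
def HasSlope (h : (Circle × Circle) ≃ₜ (Circle × Circle)) (p q : ℤ) : Prop :=
  ContinuousMap.Homotopic
    (⟨fun v => h (1, v), by fun_prop⟩ : C(Circle, Circle × Circle))
    ⟨fun v => (v ^ q, v ^ p), (continuous_zpow q).prodMk (continuous_zpow p)⟩

/-- The element of the free group on `a = 0`, `b = 1` given by a word in the letters `a`, `b`, without
inverses. -/
def positiveWord (w : List (Fin 2)) : FreeGroup (Fin 2) :=
  (w.map FreeGroup.of).prod

/-- The relator `(w₁ a^m w₁⁻¹) b^{-r} (w₂⁻¹ a^n w₂) b^{r-k}` in the free group on `a = 0`, `b = 1`. -/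
def gbsRelator (w₁ w₂ : FreeGroup (Fin 2)) (m n k : ℕ) (r : ℤ) : FreeGroup (Fin 2) :=
  (w₁ * FreeGroup.of 0 ^ m * w₁⁻¹) * FreeGroup.of 1 ^ (-r) *
    (w₂⁻¹ * FreeGroup.of 0 ^ n * w₂) * FreeGroup.of 1 ^ (r - (k : ℤ))

end

/-! The knot group surjects onto the fundamental group of the surgered manifold, and μ^p λ^q dies
there. So it suffices to treat a group G generated by images A, B of a, b in which the relator and
A^p L^q are trivial, L being the image of the longitude. By Bézout the commuting elements A and L
are powers of a single z, namely A = z^q and L = z^(-p), so the positive word W = A^s L A^t equals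
z^(q(s+t)-p). After inverting z if q < 0, the bound on the slope makes A a positive power of z and
gives W z^N = 1 with N ≥ 0.

Given a left order, let G act on itself by left multiplication. A cut (lower set) fixed by A is
fixed by z, hence by W, hence by B because W is a positive word containing B. It is then fixed by G,
so it is empty or everything (`IsLowerSet.eq_empty_or_univ_of_invariant`). If z > 1, then A, fixing
no proper cut, moves every point up. The relator writes B^k as a product of conjugates of A^m and
A^n, so B also moves every point up, and W z^N = 1 fails (`not_one_lt_of_gbs_relation`). Reversing
the order excludes z < 1, while z = 1 gives A = 1, which fixes every cut.

On the topological side, the surgered manifold is the union of two open sets: a copy of M - K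
(`complEmbedding`) and an open solid torus (`solidMap`), related by the radial extension of the
gluing map. Charts and the Hausdorff property come from this cover. Surjectivity on fundamental
groups only needs paths to be pushed off the new core (`map_complEmbedding_surjective`); the full
van Kampen theorem is not needed. -/

noncomputable section

/-! ### Left orders: invariant cuts and the group-theoretic obstruction -/

section LeftOrder

variable {G : Type*} [Group G]

/-- If a positive word in `A`, `B` containing `B` reflects membership in a set which `A` and `B` map
into itself, then so does `B`. -/
theorem mem_of_mul_mem_of_positiveWord {A B : G} {S : Set G} (hA : ∀ x ∈ S, A * x ∈ S)
    (hB : ∀ x ∈ S, B * x ∈ S) {w : List (Fin 2)} (hw : 1 ∈ w)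
    (hW : ∀ x, FreeGroup.lift ![A, B] (positiveWord w) * x ∈ S → x ∈ S) {y : G}
    (hy : B * y ∈ S) : y ∈ S := by
  have key : ∀ v : List (Fin 2), ∀ x ∈ S, FreeGroup.lift ![A, B] (positiveWord v) * x ∈ S := by
    intro v
    induction v with
    | nil => intro x hx; simpa [positiveWord] using hx
    | cons i v ih =>
      intro x hx
      have h1 : FreeGroup.lift ![A, B] (positiveWord (i :: v)) * x =
          ![A, B] i * (FreeGroup.lift ![A, B] (positiveWord v) * x) := by
        simp [positiveWord, mul_assoc]
      rw [h1]
      fin_cases i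
      · exact hA _ (ih x hx)
      · exact hB _ (ih x hx)
  obtain ⟨u, v, rfl⟩ := List.append_of_mem hw
  by_contra hyS
  -- With the word split as u · 1 · v around a letter `B`, this point is chosen so that the whole
  -- word sends it to the u-part applied to `B * y`, which lies in `S`.
  have hx : (FreeGroup.lift ![A, B] (positiveWord v))⁻¹ * y ∈ S := by
    apply hW
    have h1 : FreeGroup.lift ![A, B] (positiveWord (u ++ 1 :: v)) *
        ((FreeGroup.lift ![A, B] (positiveWord v))⁻¹ * y) =
          FreeGroup.lift ![A, B] (positiveWord u) * (B * y) := by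
      simp [positiveWord, mul_assoc]
    rw [h1]
    exact key u _ hy
  exact hyS (by simpa using key v _ hx)

variable [LinearOrder G] [MulLeftMono G]

/-- A lower set which is invariant under a positive power of `z` is invariant under `z`. -/
theorem IsLowerSet.mul_mem_iff_of_pow {z : G} {n : ℕ} (hn : 0 < n) {D : Set G} (hD : IsLowerSet D)
    (h : ∀ x, z ^ n * x ∈ D ↔ x ∈ D) (x : G) : z * x ∈ D ↔ x ∈ D := by
  obtain ⟨n, rfl⟩ : ∃ k, n = k + 1 := ⟨n - 1, by omega⟩
  -- Translates of a lower set are lower sets, so zD and D are comparable by inclusion. Either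
  -- inclusion iterates up to the power, where equality holds, and is therefore an equality.
  by_cases hz : ∀ x ∈ D, z * x ∈ D
  · have hz' : ∀ k : ℕ, ∀ x ∈ D, z ^ k * x ∈ D := by
      intro k
      induction k with
      | zero => simp
      | succ k ih => intro x hx; rw [pow_succ, mul_assoc]; exact ih _ (hz x hx)
    refine ⟨fun hx => ?_, hz x⟩
    rw [← h, pow_succ, mul_assoc]
    exact hz' n _ hx
  · push Not at hz
    obtain ⟨y, hy, hzy⟩ := hz
    have hz : ∀ x, z * x ∈ D → x ∈ D := by
      intro x hx
      by_contra hxD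
      have h1 : z * x < z * y := by
        rcases lt_or_ge (z * x) (z * y) with h1 | h1
        · exact h1
        · exact absurd (hD h1 hx) hzy
      have h2 : x < y := lt_of_mul_lt_mul_left' h1
      exact hxD (hD h2.le hy)
    have hz' : ∀ k : ℕ, ∀ x, z ^ k * x ∈ D → x ∈ D := by
      intro k
      induction k with
      | zero => simp
      | succ k ih =>
        intro x hx
        rw [pow_succ, mul_assoc] at hx
        exact hz _ (ih _ hx)
    refine ⟨hz x, fun hx => ?_⟩
    rw [← h, pow_succ, mul_assoc] at hx
    exact hz' n _ hx

/-- A lower set which is invariant under `A` is trivial, if a positive word containing `B` and a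
positive power which is `A` come from the same cyclic subgroup. -/
theorem IsLowerSet.eq_empty_or_univ_of_invariant {A B z : G} {n N : ℕ} (hn : 0 < n)
    (hgen : Subgroup.closure {A, B} = ⊤) {w : List (Fin 2)} (hw : 1 ∈ w) (hA : A = z ^ n)
    (hW : FreeGroup.lift ![A, B] (positiveWord w) * z ^ N = 1) {D : Set G} (hD : IsLowerSet D)
    (h : ∀ x, A * x ∈ D ↔ x ∈ D) : D = ∅ ∨ D = univ := by
  have hz : ∀ x, z * x ∈ D ↔ x ∈ D := hD.mul_mem_iff_of_pow hn (by rwa [← hA])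
  have hzN : ∀ k : ℕ, ∀ x, z ^ k * x ∈ D ↔ x ∈ D := by
    intro k
    induction k with
    | zero => simp
    | succ k ih => intro x; rw [pow_succ, mul_assoc, ih, hz]
  have hWD : ∀ x, FreeGroup.lift ![A, B] (positiveWord w) * x ∈ D ↔ x ∈ D := by
    intro x
    rw [eq_inv_of_mul_eq_one_left hW, ← hzN N, mul_inv_cancel_left]
  have hB : ∀ x, B * x ∈ D ↔ x ∈ D := by
    by_cases hB : ∀ x ∈ D, B * x ∈ D
    · exact fun x => ⟨fun hx => mem_of_mul_mem_of_positiveWord (fun x hx => (h x).2 hx) hB hw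
        (fun x hx => (hWD x).1 hx) hx, hB x⟩
    · push Not at hB
      obtain ⟨y, hy, hBy⟩ := hB
      -- If BD is not contained in D, then `B` preserves the complement by comparability, and the
      -- positive-word argument runs on `Dᶜ` instead.
      have hB : ∀ x ∈ Dᶜ, B * x ∈ Dᶜ := by
        intro x hx hBx
        apply hx
        rcases lt_or_ge (B * x) (B * y) with h1 | h1
        · exact hD (lt_of_mul_lt_mul_left' h1).le hy
        · exact absurd (hD h1 hBx) hBy
      have hB' : ∀ x, B * x ∈ Dᶜ → x ∈ Dᶜ := fun x hx =>
        mem_of_mul_mem_of_positiveWord (S := Dᶜ) (fun x hx hAx => hx ((h x).1 hAx)) hB hw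
        (fun x hx hx' => hx ((hWD x).2 hx')) hx
      exact fun x => ⟨fun hx => by_contra fun hx' => hB x hx' hx,
        fun hx => by_contra fun hx' => hB' x hx' hx⟩
  let H : Subgroup G :=
    { carrier := {g | ∀ x, g * x ∈ D ↔ x ∈ D}
      one_mem' := by simp
      mul_mem' := by
        intro a b ha hb x
        rw [mul_assoc, ha, hb]
      inv_mem' := by
        intro a ha x
        rw [← ha, mul_inv_cancel_left] }
  have hH : H = ⊤ := by
    rw [eq_top_iff, ← hgen, Subgroup.closure_le]
    rintro g (rfl | rfl)
    · exact h
    · exact hB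
  have hall : ∀ g x, g * x ∈ D ↔ x ∈ D := fun g => by
    have : g ∈ H := by rw [hH]; trivial
    exact this
  rcases D.eq_empty_or_nonempty with h0 | ⟨x, hx⟩
  · exact Or.inl h0
  · refine Or.inr (eq_univ_of_forall fun y => ?_)
    have := (hall (y * x⁻¹) x).2 hx
    simpa using this

/-- The points below some A^i g form an A-invariant cut, so every A-orbit is cofinal. If A g ≤ g,
the points A^k g stay below g; comparing with the orbit of 1 bounds A^k for all k, which contradicts
1 < A. -/
theorem lt_mul_of_forall_invariant_trivial {A : G} (hA : 1 < A)
    (h : ∀ D : Set G, IsLowerSet D → (∀ x, A * x ∈ D ↔ x ∈ D) → D = ∅ ∨ D = univ) (g : G) :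
    g < A * g := by
  have cofinal : ∀ g x : G, ∃ i : ℤ, x ≤ A ^ i * g := by
    intro g x
    have h1 : {x | ∃ i : ℤ, x ≤ A ^ i * g} = univ := by
      refine (h _ ?_ ?_).resolve_left (Set.Nonempty.ne_empty ⟨g, 0, by simp⟩)
      · rintro a b hba ⟨i, hi⟩
        exact ⟨i, hba.trans hi⟩
      · intro x
        constructor
        · rintro ⟨i, hi⟩
          refine ⟨-1 + i, ?_⟩
          rw [zpow_add, zpow_neg_one, mul_assoc, le_inv_mul_iff_mul_le]
          exact hi
        · rintro ⟨i, hi⟩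
          refine ⟨1 + i, ?_⟩
          rw [zpow_add, zpow_one, mul_assoc]
          exact mul_le_mul_right hi A
    exact (Set.ext_iff.1 h1 x).2 trivial
  by_contra! hg
  obtain ⟨i, hi⟩ := cofinal g 1
  obtain ⟨j, hj⟩ := cofinal 1 g
  have hk : ∀ k : ℕ, A ^ k * g ≤ g := by
    intro k
    induction k with
    | zero => simp
    | succ k ih =>
      rw [pow_succ, mul_assoc]
      exact (mul_le_mul_right hg _).trans ih
  -- From A^(-i) ≤ g ≤ A^j and A^k g ≤ g follows A^(k-i-j) ≤ 1; this k makes the exponent positive.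
  set k : ℕ := i.natAbs + j.natAbs + 1
  obtain ⟨l, hl⟩ : ∃ l : ℕ, (k : ℤ) - i - j = l + 1 := ⟨(k - i - j - 1).toNat, by omega⟩
  have h1 : A ^ (-j) * (A ^ (-i) * A ^ k) ≤ 1 := by
    have h2 : A ^ (-i) ≤ g := by
      rw [zpow_neg, ← one_mul g, ← mul_one (A ^ i)⁻¹, one_mul g, inv_mul_le_iff_le_mul]
      exact hi
    have h3 : A ^ k * A ^ (-i) ≤ A ^ j := by
      refine (mul_le_mul_right h2 _).trans ((hk k).trans ?_)
      simpa using hj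
    rw [zpow_neg, inv_mul_le_iff_le_mul, mul_one, ← zpow_natCast, ← zpow_add, add_comm, zpow_add,
      zpow_natCast]
    exact h3
  rw [← zpow_natCast, ← zpow_add, ← zpow_add, show -j + (-i + (k : ℤ)) = ((l + 1 : ℕ) : ℤ) by
    push_cast; omega, zpow_natCast] at h1
  exact absurd h1 (not_le.2 (one_lt_pow' hA (by omega)))

theorem mul_le_self_pow {A : G} {x : G} (h : A * x ≤ x) (k : ℕ) : A ^ k * x ≤ x := by
  induction k with
  | zero => simp
  | succ k ih =>
    rw [pow_succ, mul_assoc]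
    exact (mul_le_mul_right h _).trans ih

/-- If z > 1, every factor of W z^N moves all points up, at least weakly, and the letter `B` in W
does so strictly, so the product cannot be 1. -/
theorem not_one_lt_of_gbs_relation {A B z : G} {n' N : ℕ} (hn : 0 < n')
    (hgen : Subgroup.closure {A, B} = ⊤) {w : List (Fin 2)} (hw : 1 ∈ w) (hA : A = z ^ n')
    (hW : FreeGroup.lift ![A, B] (positiveWord w) * z ^ N = 1)
    {w₁ w₂ : FreeGroup (Fin 2)} {m n k : ℕ} {r : ℤ} (hmn : m ≠ 0 ∨ n ≠ 0)
    (hrel : FreeGroup.lift ![A, B] (gbsRelator w₁ w₂ m n k r) = 1) : ¬ 1 < z := by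
  intro hz1
  have hA1 : 1 < A := by rw [hA]; exact one_lt_pow' hz1 hn.ne'
  have hAlt : ∀ g, g < A * g := lt_mul_of_forall_invariant_trivial hA1
    fun D hD h => hD.eq_empty_or_univ_of_invariant hn hgen hw hA hW h
  have hzlt : ∀ g, g < z * g := by
    intro g
    by_contra! hg
    have h1 := mul_le_self_pow hg n'
    rw [← hA] at h1
    exact absurd (hAlt g) (not_lt.2 h1)
  have hApow : ∀ (l : ℕ) (g : G), g ≤ A ^ l * g := by
    intro l
    induction l with
    | zero => simp
    | succ l ih =>
      intro g
      rw [pow_succ, mul_assoc]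
      exact (hAlt g).le.trans (ih _)
  have hApow' : ∀ (l : ℕ) (g : G), l ≠ 0 → g < A ^ l * g := by
    intro l g hl
    obtain ⟨l, rfl⟩ := Nat.exists_eq_succ_of_ne_zero hl
    rw [pow_succ, mul_assoc]
    exact (hAlt g).trans_le (hApow _ _)
  have hconj : ∀ (l : ℕ) (c g : G), g ≤ c * A ^ l * c⁻¹ * g := by
    intro l c g
    have := mul_le_mul_right (hApow l (c⁻¹ * g)) c
    simpa [mul_assoc] using this
  have hconj' : ∀ (l : ℕ) (c g : G), l ≠ 0 → g < c * A ^ l * c⁻¹ * g := by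
    intro l c g hl
    have := mul_lt_mul_right (hApow' l (c⁻¹ * g) hl) c
    simpa [mul_assoc] using this
  have hBk : ∀ g, g < B ^ k * g := by
    intro g
    set c₁ := FreeGroup.lift ![A, B] w₁
    set c₂ := FreeGroup.lift ![A, B] w₂
    -- The relator solved for B^k: a conjugate of A^m times a conjugate of A^n, and one of the
    -- exponents is nonzero.
    have h1 : B ^ k = (c₁ * A ^ m * c₁⁻¹) * ((c₂ * B ^ r)⁻¹ * A ^ n * ((c₂ * B ^ r)⁻¹)⁻¹) := by
      have h2 : (c₁ * A ^ m * c₁⁻¹) * ((c₂ * B ^ r)⁻¹ * A ^ n * ((c₂ * B ^ r)⁻¹)⁻¹) * (B ^ k)⁻¹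
          = 1 := by
        rw [← hrel]
        simp [gbsRelator, mul_assoc, c₁, c₂, zpow_sub]
      exact (mul_inv_eq_one.1 h2).symm
    rw [h1, mul_assoc]
    rcases hmn with h | h
    · exact (hconj n _ g).trans_lt (hconj' m c₁ _ h)
    · exact (hconj' n _ g h).trans_le (hconj m c₁ _)
  have hB : ∀ g, g < B * g := by
    intro g
    -- The case k = 0 needs no separate treatment, since `hBk` then already reads g < g.
    by_contra! hg
    exact absurd (hBk g) (not_lt.2 (mul_le_self_pow hg k))
  have hpos : ∀ v : List (Fin 2), ∀ g, g ≤ FreeGroup.lift ![A, B] (positiveWord v) * g := by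
    intro v
    induction v with
    | nil => intro g; simp [positiveWord]
    | cons i v ih =>
      intro g
      have h1 : FreeGroup.lift ![A, B] (positiveWord (i :: v)) * g =
          ![A, B] i * (FreeGroup.lift ![A, B] (positiveWord v) * g) := by
        simp [positiveWord, mul_assoc]
      rw [h1]
      refine (ih g).trans ?_
      fin_cases i
      · exact (hAlt _).le
      · exact (hB _).le
  obtain ⟨u, v, rfl⟩ := List.append_of_mem hw
  have h2 : ∀ l : ℕ, ∀ g, g ≤ z ^ l * g := by
    intro l
    induction l with
    | zero => simp
    | succ l ih =>
      intro g
      rw [pow_succ, mul_assoc]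
      exact (hzlt g).le.trans (ih _)
  have h3 : (1 : G) < FreeGroup.lift ![A, B] (positiveWord (u ++ 1 :: v)) * z ^ N := by
    have h4 : FreeGroup.lift ![A, B] (positiveWord (u ++ 1 :: v)) * z ^ N =
        FreeGroup.lift ![A, B] (positiveWord u) *
          (B * (FreeGroup.lift ![A, B] (positiveWord v) * z ^ N)) := by
      simp [positiveWord, mul_assoc]
    rw [h4]
    have h5 : 1 ≤ z ^ N := by simpa using h2 N 1
    exact (h5.trans (hpos v _)).trans_lt ((hB _).trans_le (hpos u _))
  exact absurd hW h3.ne'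

end LeftOrder

/-- The group-theoretic core: a quotient of the group of the generalised Baumslag-Solitar relator in
which the slope `p/q` dies is not left-orderable. -/
theorem not_isLeftOrderable_of_gbs_relation {G : Type*} [Group G] {A B L : G}
    (hgen : Subgroup.closure {A, B} = ⊤) {w : List (Fin 2)} (hw : 1 ∈ w)
    {w₁ w₂ : FreeGroup (Fin 2)} {m n k : ℕ} {r : ℤ} (hmn : m ≠ 0 ∨ n ≠ 0)
    (hrel : FreeGroup.lift ![A, B] (gbsRelator w₁ w₂ m n k r) = 1) {s t : ℤ}
    (hL : L = A ^ (-s) * FreeGroup.lift ![A, B] (positiveWord w) * A ^ (-t)) (hcomm : Commute A L)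
    {p q : ℤ} (hpq : IsCoprime p q) (hq : q ≠ 0) (hslope : (s : ℚ) + t ≤ p / q)
    (hfill : A ^ p * L ^ q = 1) : ¬ IsLeftOrderable G := by
  rintro ⟨hnt, hord, hmul⟩
  have hmono : MulLeftStrictMono G := ⟨fun f g h hgh => hmul f h g hgh⟩
  have hmono' : MulLeftMono G := ⟨covariant_le_of_covariant_lt _ _ _ hmono.elim⟩
  obtain ⟨u, v, huv⟩ := hpq
  set W := FreeGroup.lift ![A, B] (positiveWord w) with hWdef
  -- With u p + v q = 1, the element A^v L^(-u) generates the image of the peripheral subgroup.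
  have hzq : (A ^ v * L ^ (-u)) ^ q = A := by
    rw [(hcomm.zpow_zpow v (-u)).mul_zpow, ← zpow_mul, ← zpow_mul]
    have h1 : A * (A ^ p * L ^ q) ^ (-u) = A := by rw [hfill, one_zpow, mul_one]
    rw [(hcomm.zpow_zpow p q).mul_zpow, ← zpow_mul, ← zpow_mul, ← mul_assoc, ← zpow_one_add] at h1
    rw [show v * q = 1 + p * (-u) by linear_combination huv, show -u * q = q * -u by ring]
    exact h1
  have hzp : (A ^ v * L ^ (-u)) ^ (-p) = L := by
    rw [(hcomm.zpow_zpow v (-u)).mul_zpow, ← zpow_mul, ← zpow_mul]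
    have h1 : (A ^ p * L ^ q) ^ (-v) * L = L := by rw [hfill, one_zpow, one_mul]
    rw [(hcomm.zpow_zpow p q).mul_zpow, ← zpow_mul, ← zpow_mul, mul_assoc, ← zpow_add_one] at h1
    rw [show v * -p = p * -v by ring, show -u * -p = q * -v + 1 by linear_combination huv]
    exact h1
  have hWeq : W = A ^ s * L * A ^ t := by
    rw [hL]; simp [mul_assoc]
  obtain ⟨z, n', N, hn', hA, hWz⟩ : ∃ (z : G) (n' N : ℕ), 0 < n' ∧ A = z ^ n' ∧ W * z ^ N = 1 := by
    set z := A ^ v * L ^ (-u)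
    have hWz : W = z ^ (q * (s + t) - p) := by
      rw [hWeq, ← hzp, ← hzq, ← zpow_mul, ← zpow_mul, ← zpow_add, ← zpow_add]
      congr 1; ring
    -- Clearing the denominator reverses the slope inequality when q < 0; passing to z⁻¹ restores
    -- nonnegative exponents.
    rcases lt_or_gt_of_ne hq with hq | hq
    · have hle : 0 ≤ q * (s + t) - p := by
        have hq' : (q : ℚ) < 0 := by exact_mod_cast hq
        rw [le_div_iff_of_neg hq'] at hslope
        have : p ≤ (s + t) * q := by exact_mod_cast hslope
        linarith
      refine ⟨z⁻¹, (-q).toNat, (q * (s + t) - p).toNat, by omega, ?_, ?_⟩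
      · rw [← zpow_natCast, Int.toNat_of_nonneg (by omega), inv_zpow, zpow_neg, inv_inv, hzq]
      · rw [← zpow_natCast, Int.toNat_of_nonneg hle, inv_zpow, hWz, mul_inv_cancel]
    · have hle : 0 ≤ p - q * (s + t) := by
        have hq' : (0 : ℚ) < q := by exact_mod_cast hq
        rw [le_div_iff₀ hq'] at hslope
        have : (s + t) * q ≤ p := by exact_mod_cast hslope
        linarith
      refine ⟨z, q.toNat, (p - q * (s + t)).toNat, by omega, ?_, ?_⟩
      · rw [← zpow_natCast, Int.toNat_of_nonneg (by omega), hzq]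
      · rw [← zpow_natCast, Int.toNat_of_nonneg hle, hWz, ← zpow_add]
        simp
  have h1 : ¬ 1 < z := not_one_lt_of_gbs_relation hn' hgen hw hA hWz hmn hrel
  -- In the reversed order, which is again left-invariant, z < 1 reads as 1 < z.
  have h2 : ¬ z < 1 := by
    have := @not_one_lt_of_gbs_relation G _ (@OrderDual.instLinearOrder G hord)
      ⟨fun f _ _ hgh => hmono'.elim f hgh⟩ A B z n' N hn' hgen w hw hA hWz w₁ w₂ m n k r hmn hrel
    exact this
  have hz : z = 1 := le_antisymm (not_lt.1 h1) (not_lt.1 h2)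
  have hA1 : A = 1 := by rw [hA, hz, one_pow]
  -- Since A = 1 fixes every cut, the cut of elements ≤ 1 must be trivial, which is impossible in a
  -- nontrivial ordered group.
  rcases isLowerSet_Iic (1 : G) |>.eq_empty_or_univ_of_invariant hn' hgen hw hA hWz
    (by simp [hA1]) with h | h
  · exact (h ▸ (le_refl (1 : G)) : (1 : G) ∈ (∅ : Set G))
  · have hall : ∀ g : G, g ≤ 1 := fun g => (Set.ext_iff.1 h g).2 trivial
    obtain ⟨g, hg⟩ := exists_ne (1 : G)
    have h3 := mul_lt_mul_right (lt_of_le_of_ne (hall g) hg) g⁻¹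
    rw [inv_mul_cancel, mul_one] at h3
    exact absurd h3 (not_lt.2 (hall _))

theorem not_isLeftOrderable_of_presentation {Γ G : Type*} [Group Γ] [Group G]
    {w₁ w₂ : FreeGroup (Fin 2)} {m n k : ℕ} {r : ℤ} (hmn : m ≠ 0 ∨ n ≠ 0)
    (e : PresentedGroup {gbsRelator w₁ w₂ m n k r} ≃* Γ) {s t : ℤ} {w : List (Fin 2)} (hw : 1 ∈ w)
    {μ l : Γ} (hμ : e (PresentedGroup.mk _ (FreeGroup.of 0)) = μ)
    (hl : e (PresentedGroup.mk _
      (FreeGroup.of 0 ^ (-s) * positiveWord w * FreeGroup.of 0 ^ (-t))) = l) (hcomm : Commute μ l)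
    {p q : ℤ} (hpq : IsCoprime p q) (hq : q ≠ 0) (hslope : (s : ℚ) + t ≤ p / q) {φ : Γ →* G}
    (hφ : Function.Surjective φ) (hfill : φ (μ ^ p * l ^ q) = 1) : ¬ IsLeftOrderable G := by
  let Φ : FreeGroup (Fin 2) →* G := (φ.comp e.toMonoidHom).comp (PresentedGroup.mk _)
  have hΦ : Function.Surjective Φ :=
    (hφ.comp e.surjective).comp (PresentedGroup.mk_surjective _)
  have hΦ0 : Φ (FreeGroup.of 0) = φ μ := congrArg φ hμ
  have hΦL : Φ (FreeGroup.of 0 ^ (-s) * positiveWord w * FreeGroup.of 0 ^ (-t)) = φ l :=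
    congrArg φ hl
  have hΦrel : Φ (gbsRelator w₁ w₂ m n k r) = 1 := by
    have h1 : PresentedGroup.mk {gbsRelator w₁ w₂ m n k r} (gbsRelator w₁ w₂ m n k r) = 1 :=
      PresentedGroup.one_of_mem (mem_singleton _)
    simp only [Φ, MonoidHom.comp_apply, h1, map_one]
  clear_value Φ
  have hΦeq : Φ = FreeGroup.lift ![Φ (FreeGroup.of 0), Φ (FreeGroup.of 1)] := by
    refine FreeGroup.ext_hom _ _ fun i => ?_
    fin_cases i <;> simp
  refine not_isLeftOrderable_of_gbs_relation (A := Φ (FreeGroup.of 0)) (B := Φ (FreeGroup.of 1))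
    (L := φ l) (w₁ := w₁) (w₂ := w₂) (k := k) (r := r) (s := s) (t := t)
    ?_ hw hmn ?_ ?_ ?_ hpq hq hslope ?_
  · rw [hΦeq, FreeGroup.lift_surjective_iff_closure_range_eq_top] at hΦ
    rw [← hΦ]
    congr 1
    rw [Matrix.range_cons, Matrix.range_cons, Matrix.range_empty, union_empty, singleton_union]
  · rw [← hΦeq, hΦrel]
  · rw [← hΦL, ← hΦeq, map_mul, map_mul, map_zpow, map_zpow]
  · rw [hΦ0]
    exact hcomm.map φ
  · rw [hΦ0, ← map_zpow, ← map_zpow, ← map_mul, hfill]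

/-! ### Pushing paths into an open set; loops in topological groups -/

section Homotopy

open scoped unitInterval

variable {X Y : Type*} [TopologicalSpace X] [TopologicalSpace Y]

/-- A property of homotopy classes of paths which holds for the paths in the members of an open cover
and is closed under concatenation holds for all paths. -/
theorem Path.Homotopic.Quotient.induction_of_open_cover {ι : Type*} {U : ι → Set X}
    (hU : ∀ i, IsOpen (U i)) (hcov : ∀ x, ∃ i, x ∈ U i)
    (P : ∀ {x y : X}, Path.Homotopic.Quotient x y → Prop)
    (hP : ∀ (i : ι) {x y : X} (p : Path x y), range p ⊆ U i → P (.mk p))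
    (htrans : ∀ {x y z : X} (p : Path.Homotopic.Quotient x y) (q : Path.Homotopic.Quotient y z), P p → P q → P (p.trans q))
    {x y : X} (p : Path x y) : P (.mk p) := by
  obtain ⟨t, ht0, htm, ⟨n, hn⟩, ht⟩ := exists_monotone_Icc_subset_open_cover_unitInterval
    (c := fun i => p ⁻¹' U i) (fun i => (hU i).preimage p.continuous)
    (fun s _ => mem_iUnion.2 (hcov (p s)))
  -- Induction along a Lebesgue subdivision: each step appends a subpath lying in one member of the
  -- cover.
  have key : ∀ n, P (.mk (p.subpath 0 (t n))) := by
    intro n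
    induction n with
    | zero =>
      rw [ht0]
      obtain ⟨i, hi⟩ := hcov (p 0)
      refine hP i _ ?_
      rw [Path.subpath_self, Path.refl_range]
      exact singleton_subset_iff.2 hi
    | succ n ih =>
      obtain ⟨i, hi⟩ := ht n
      have h1 := htrans _ _ ih (hP i (p.subpath (t n) (t (n + 1))) (by
        rw [Path.range_subpath_of_le _ _ _ (htm n.le_succ)]
        exact image_subset_iff.2 hi))
      rw [← Path.Homotopic.Quotient.mk_trans,
        Path.Homotopic.Quotient.eq.2 ⟨Path.Homotopy.subpathTransSubpath p 0 (t n) (t (n + 1))⟩] at h1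
      exact h1
  have h1 := key n
  rw [hn n le_rfl, Path.subpath_zero_one] at h1
  -- The end points of the full subpath are p 0 and p 1, equal to x and y only propositionally.
  have h2 : ∀ {x' y' : X} (hx : x' = x) (hy : y' = y), P (.mk (p.cast hx hy)) → P (.mk p) := by
    rintro x' y' rfl rfl h
    exact h
  exact h2 _ _ h1

/-- If `X` is the union of open sets `U` and `V`, any point of `V` can be joined within `V` to a point
of `U`, and every path in `V` with end points in `U` can be pushed into `U`, then every path with
end points in `U` can be pushed into `U`. -/
theorem Path.exists_homotopic_range_subset {U V : Set X} (hU : IsOpen U) (hV : IsOpen V)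
    (hUV : ∀ x, x ∈ U ∨ x ∈ V)
    (hjoin : ∀ x ∈ V, ∃ y ∈ U, ∃ p : Path x y, range p ⊆ V)
    (hpush : ∀ x ∈ U, ∀ y ∈ U, ∀ p : Path x y, range p ⊆ V →
      ∃ p' : Path x y, range p' ⊆ U ∧ p.Homotopic p')
    {x y : X} (hx : x ∈ U) (hy : y ∈ U) (p : Path x y) :
    ∃ p' : Path x y, range p' ⊆ U ∧ p.Homotopic p' := by
  -- Each point gets a connecting path into `U` that stays inside whichever of `U`, `V` contain the
  -- point.
  have hc : ∀ x, ∃ b ∈ U, ∃ c : Path x b, (x ∈ U → range c ⊆ U) ∧ (x ∈ V → range c ⊆ V) := by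
    intro x
    by_cases hx : x ∈ U
    · exact ⟨x, hx, Path.refl x, by simp, by simp⟩
    · obtain ⟨y, hy, p, hp⟩ := hjoin x ((hUV x).resolve_left hx)
      exact ⟨y, hy, p, fun h => absurd h hx, fun _ => hp⟩
  choose b hb c hcU hcV using hc
  -- Classes c_x · ε · c_y⁻¹ with ε in `U` are closed under concatenation because the inner
  -- connecting paths cancel.
  let P : ∀ {x y : X}, Path.Homotopic.Quotient x y → Prop := fun {x y} α => ∃ ε : Path (b x) (b y),
    range ε ⊆ U ∧ α = ((Path.Homotopic.Quotient.mk (c x)).trans (.mk ε)).trans (Path.Homotopic.Quotient.mk (c y)).symm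
  have hsplit : ∀ {x y : X} (α : Path.Homotopic.Quotient x y), α = ((Path.Homotopic.Quotient.mk (c x)).trans
      (((Path.Homotopic.Quotient.mk (c x)).symm.trans α).trans (.mk (c y)))).trans (Path.Homotopic.Quotient.mk (c y)).symm := by
    intro x y α
    simp only [Path.Homotopic.Quotient.trans_assoc, Path.Homotopic.Quotient.trans_symm,
      Path.Homotopic.Quotient.trans_refl]
    rw [← Path.Homotopic.Quotient.trans_assoc, Path.Homotopic.Quotient.trans_symm,
      Path.Homotopic.Quotient.refl_trans]
  have key : P (.mk p) := by
    refine Path.Homotopic.Quotient.induction_of_open_cover (U := fun i : Bool => cond i U V)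
      (by rintro (_ | _); exacts [hV, hU]) (fun x => ?_) (fun α => P α) ?_ ?_ p
    · exact (hUV x).elim (fun h => ⟨true, h⟩) fun h => ⟨false, h⟩
    · rintro (_ | _) x y p hp
      · have hx : x ∈ V := hp p.source_mem_range
        have hy : y ∈ V := hp p.target_mem_range
        obtain ⟨ε, hε, hε'⟩ := hpush (b x) (hb x) (b y) (hb y) (((c x).symm.trans p).trans (c y)) (by
          rw [Path.trans_range, Path.trans_range, Path.symm_range]
          exact union_subset (union_subset (hcV x hx) hp) (hcV y hy))
        refine ⟨ε, hε, ?_⟩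
        rw [← Path.Homotopic.Quotient.eq.2 hε']
        exact hsplit _
      · have hx : x ∈ U := hp p.source_mem_range
        have hy : y ∈ U := hp p.target_mem_range
        refine ⟨((c x).symm.trans p).trans (c y), ?_, hsplit _⟩
        rw [Path.trans_range, Path.trans_range, Path.symm_range]
        exact union_subset (union_subset (hcU x hx) hp) (hcU y hy)
    · rintro x y z _ _ ⟨ε, hε, rfl⟩ ⟨δ, hδ, rfl⟩
      refine ⟨ε.trans δ, ?_, ?_⟩
      · rw [Path.trans_range]
        exact union_subset hε hδ
      · simp only [Path.Homotopic.Quotient.trans_assoc, Path.Homotopic.Quotient.mk_trans]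
        congr 2
        rw [← Path.Homotopic.Quotient.trans_assoc, Path.Homotopic.Quotient.symm_trans,
          Path.Homotopic.Quotient.refl_trans]
  obtain ⟨ε, hε, hε'⟩ := key
  refine ⟨((c x).trans ε).trans (c y).symm, ?_, Path.Homotopic.Quotient.eq.1 hε'⟩
  rw [Path.trans_range, Path.trans_range, Path.symm_range]
  exact union_subset (union_subset (hcU x hx) hε) (hcU y hy)

/-- A path in the image of an embedding lifts. -/
theorem Topology.IsEmbedding.exists_path_map_eq {f : X → Y} (hf : Topology.IsEmbedding f) {x y : X}
    (p : Path (f x) (f y)) (hp : range p ⊆ range f) :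
    ∃ q : Path x y, q.map hf.continuous = p := by
  choose g hg using fun t => hp (mem_range_self t)
  refine ⟨⟨⟨g, ?_⟩, hf.injective ?_, hf.injective ?_⟩, ?_⟩
  · rw [hf.continuous_iff]
    exact (funext hg : f ∘ g = p) ▸ p.continuous
  · exact (hg 0).trans p.source
  · exact (hg 1).trans p.target
  · ext t
    exact hg t

/-- Surjectivity of the map on fundamental groups induced by an open embedding whose image, together
with the image of another open embedding, covers the space. -/
theorem FundamentalGroup.map_surjective_of_isOpenEmbedding {A B : Type*} [TopologicalSpace A]
    [TopologicalSpace B] (j : C(A, X)) (i : C(B, X)) (hj : Topology.IsOpenEmbedding j)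
    (hi : Topology.IsOpenEmbedding i) (hcov : ∀ x, x ∈ range j ∨ x ∈ range i) [PathConnectedSpace B]
    (hne : ∃ b, i b ∈ range j)
    (hpush : ∀ b b' : B, i b ∈ range j → i b' ∈ range j → ∀ p : Path b b',
      ∃ p' : Path b b', (∀ t, i (p' t) ∈ range j) ∧ p.Homotopic p') (a : A) :
    Function.Surjective (FundamentalGroup.map j a) := by
  intro α
  induction α using Path.Homotopic.Quotient.ind with | mk p => ?_
  obtain ⟨p', hp', hpp'⟩ := Path.exists_homotopic_range_subset hj.isOpen_range hi.isOpen_range hcov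
    (by
      rintro _ ⟨b, rfl⟩
      obtain ⟨b', hb'⟩ := hne
      refine ⟨i b', hb', (PathConnectedSpace.somePath b b').map i.continuous, ?_⟩
      rintro _ ⟨t, rfl⟩
      exact mem_range_self _)
    (by
      rintro x hx y hy p hp
      obtain ⟨b, rfl⟩ := hp p.source_mem_range
      obtain ⟨b', rfl⟩ := hp p.target_mem_range
      obtain ⟨q, rfl⟩ := hi.isEmbedding.exists_path_map_eq p hp
      obtain ⟨q', hq', hqq'⟩ := hpush b b' hx hy q
      refine ⟨q'.map i.continuous, ?_, hqq'.map i⟩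
      rintro _ ⟨t, rfl⟩
      exact hq' t)
    (mem_range_self a) (mem_range_self a) p
  obtain ⟨q, rfl⟩ := hj.isEmbedding.exists_path_map_eq p' hp'
  exact ⟨.mk q, (Path.Homotopic.Quotient.eq.2 hpp').symm⟩

/-- A map which is freely homotopic to a constant map sends every loop to a null-homotopic
loop. -/
theorem mk_map_eq_refl_of_homotopic_const {f : C(X, Y)} {y : Y}
    (h : f.Homotopic (ContinuousMap.const X y)) {x : X} (p : Path x x) :
    Path.Homotopic.Quotient.mk (p.map f.continuous) = Path.Homotopic.Quotient.refl (f x) := by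
  obtain ⟨H⟩ := h
  -- The homotopy may move the base point; its trace `H.evalAt x` conjugates the image loop to a
  -- constant one.
  have h1 := Path.Homotopic.Quotient.eq.2 (Path.Homotopic.map_trans_evalAt H p)
  have h2 : p.map (ContinuousMap.const X y).continuous = Path.refl y := by
    ext; rfl
  have h3 : Path.Homotopic.Quotient.mk (p.map f.continuous) =
    ((Path.Homotopic.Quotient.mk (p.map f.continuous)).trans
      (.mk (H.evalAt x))).trans (Path.Homotopic.Quotient.mk (H.evalAt x)).symm := by
    simp
  rw [h3, ← Path.Homotopic.Quotient.mk_trans, h1]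
  simp only [Path.Homotopic.Quotient.mk_trans]
  erw [h2]
  simp

/-- Pointed maps from a space to a topological group, as a subgroup of all maps. -/
def pointedMaps (X : Type*) [TopologicalSpace X] (x : X) (T : Type*) [TopologicalSpace T] [Group T]
    [IsTopologicalGroup T] : Subgroup C(X, T) where
  carrier := {f | f x = 1}
  one_mem' := rfl
  mul_mem' {f g} hf hg := by
    change f x * g x = 1
    rw [show f x = 1 from hf, show g x = 1 from hg, one_mul]
  inv_mem' {f} hf := by
    change (f x)⁻¹ = 1
    rw [show f x = 1 from hf, inv_one]

variable {T : Type*} [TopologicalSpace T] [CommGroup T] [IsTopologicalGroup T]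

/-- The class of the image of a loop under a pointed map to a topological group. -/
def loopClass {x : X} (c : Path x x) : pointedMaps X x T →* FundamentalGroup T 1 where
  toFun f := FundamentalGroup.fromPath (.mk ((c.map f.1.continuous).cast f.2.symm f.2.symm))
  map_one' := by
    rw [FundamentalGroup.one_def, ← Path.Homotopic.Quotient.mk_refl]
    congr 1
  map_mul' f g := by
    have h1 : ∀ p q : Path (1 : T) 1, Path.Homotopic.Quotient.mk
        ((p.mul q).cast (mul_one 1).symm (mul_one 1).symm) =
          (Path.Homotopic.Quotient.mk q).trans (.mk p) := by
      intro p q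
      -- Eckmann–Hilton: in T × T the diagonal path (p, q) is homotopic to running q and then p;
      -- multiplication T × T → T carries this to T.
      have h2 : ((Path.refl 1).prod q).trans (p.prod (Path.refl 1)) |>.Homotopic (p.prod q) := by
        rw [Path.trans_prod_eq_prod_trans]
        exact ⟨Path.Homotopic.prodHomotopy (Path.Homotopy.reflTrans _) (Path.Homotopy.transRefl _)⟩
      have h3 := h2.map (⟨fun z => z.1 * z.2, by fun_prop⟩ : C(T × T, T))
      have h4 := Path.Homotopic.Quotient.eq.2 (h3.pathCast (mul_one 1).symm (mul_one 1).symm)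
      rw [← Path.Homotopic.Quotient.mk_trans]
      refine Eq.trans ?_ (h4.symm.trans ?_)
      · congr 1
      · congr 1
        rw [Path.map_trans]
        ext t
        simp [Path.trans_apply]
    rw [FundamentalGroup.mul_def]
    refine Eq.trans ?_ (h1 _ _)
    congr 1

theorem map_loopClass_eq_one {x : X} {c : Path x x} {f : pointedMaps X x T} (g : C(T, Y))
    (h : Path.Homotopic.Quotient.mk (c.map (g.comp f.1).continuous) =
      Path.Homotopic.Quotient.refl _) : FundamentalGroup.map g 1 (loopClass c f) = 1 := by
  have hf : g 1 = (g.comp f.1) x := congrArg g f.2.symm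
  have h1 : FundamentalGroup.map g 1 (loopClass c f) =
      (Path.Homotopic.Quotient.mk (c.map (g.comp f.1).continuous)).cast hf hf := rfl
  rw [h1, h, ← Path.Homotopic.Quotient.mk_refl, ← Path.Homotopic.Quotient.mk_cast]
  have h2 : (Path.refl ((g.comp f.1) x)).cast hf hf = Path.refl (g 1) := by
    ext t
    exact hf.symm
  rw [h2]
  rfl

end Homotopy

/-! ### Radial extension of torus maps -/

section Cone

/-- The direction of a complex number, with the value `1` at `0`. -/
def complexDir (z : ℂ) : Circle :=
  if hz : z = 0 then 1 else ⟨z / (‖z‖ : ℂ), by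
    simp [Submonoid.unitSphere, norm_ne_zero_iff.2 hz]⟩

theorem coe_complexDir {z : ℂ} (hz : z ≠ 0) : (complexDir z : ℂ) = z / (‖z‖ : ℂ) := by
  simp [complexDir, hz]

theorem norm_mul_complexDir (z : ℂ) : (‖z‖ : ℂ) * complexDir z = z := by
  rcases eq_or_ne z 0 with rfl | hz
  · simp
  · have h : (‖z‖ : ℂ) ≠ 0 := by exact_mod_cast norm_ne_zero_iff.2 hz
    rw [coe_complexDir hz]
    field_simp

theorem complexDir_real_mul {ρ : ℝ} (hρ : 0 < ρ) (v : Circle) :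
    complexDir ((ρ : ℂ) * v) = v := by
  have h : (ρ : ℂ) * v ≠ 0 := mul_ne_zero (by exact_mod_cast hρ.ne') v.coe_ne_zero
  have h1 : (ρ : ℂ) ≠ 0 := by exact_mod_cast hρ.ne'
  apply Circle.ext
  rw [coe_complexDir h, norm_mul, Circle.norm_coe, mul_one, Complex.norm_real,
    Real.norm_of_nonneg hρ.le]
  field_simp

theorem complexDir_coe (v : Circle) : complexDir v = v := by
  simpa using complexDir_real_mul one_pos v

theorem continuousOn_complexDir : ContinuousOn complexDir {0}ᶜ := by
  have h : ContinuousOn (fun z : ℂ => (complexDir z : ℂ)) {0}ᶜ := by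
    refine ContinuousOn.congr (f := fun z : ℂ => z / (‖z‖ : ℂ)) ?_ fun z hz => coe_complexDir hz
    refine continuousOn_id.div (by fun_prop) fun z hz => ?_
    exact_mod_cast norm_ne_zero_iff.2 hz
  rw [continuousOn_iff_continuous_domRestrict] at h ⊢
  exact continuous_induced_rng.2 h

/-- The radial extension of a self-map of the torus. -/
def torusCone (f : Circle × Circle → Circle × Circle) (x : Circle × ℂ) : Circle × ℂ :=
  ((f (x.1, complexDir x.2)).1, (‖x.2‖ : ℂ) * (f (x.1, complexDir x.2)).2)

@[simp]
theorem norm_torusCone_snd (f : Circle × Circle → Circle × Circle) (x : Circle × ℂ) :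
    ‖(torusCone f x).2‖ = ‖x.2‖ := by
  simp [torusCone, Circle.norm_coe]

theorem torusCone_snd_eq_zero {f : Circle × Circle → Circle × Circle} {x : Circle × ℂ} :
    (torusCone f x).2 = 0 ↔ x.2 = 0 := by
  rw [← norm_eq_zero, norm_torusCone_snd, norm_eq_zero]

theorem torusCone_coe (f : Circle × Circle → Circle × Circle) (u v : Circle) :
    torusCone f (u, (v : ℂ)) = ((f (u, v)).1, ((f (u, v)).2 : ℂ)) := by
  simp [torusCone, complexDir_coe, Circle.norm_coe]

/-- On each torus of positive radius the cone acts as `f` and keeps the radius. On the core the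
direction is lost, so the inverse law can fail there. -/
theorem torusCone_torusCone {f g : Circle × Circle → Circle × Circle} (h : ∀ z, g (f z) = z)
    {x : Circle × ℂ} (hx : x.2 ≠ 0) : torusCone g (torusCone f x) = x := by
  have h1 : complexDir (torusCone f x).2 = (f (x.1, complexDir x.2)).2 :=
    complexDir_real_mul (norm_pos_iff.2 hx) _
  have h2 : g ((torusCone f x).1, complexDir (torusCone f x).2) = (x.1, complexDir x.2) := by
    rw [h1]
    exact h _
  refine Prod.ext ?_ ?_
  · exact (congrArg Prod.fst h2 :)
  · rw [torusCone, h2, norm_torusCone_snd]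
    exact norm_mul_complexDir _

theorem continuousOn_torusCone {f : Circle × Circle → Circle × Circle} (hf : Continuous f) :
    ContinuousOn (torusCone f) {x | x.2 ≠ 0} := by
  have h1 : ContinuousOn (fun x : Circle × ℂ => f (x.1, complexDir x.2)) {x | x.2 ≠ 0} := by
    refine hf.comp_continuousOn (continuousOn_fst.prodMk ?_)
    exact continuousOn_complexDir.comp continuousOn_snd fun x hx => hx
  refine (continuous_fst.comp_continuousOn h1).prodMk (ContinuousOn.mul (by fun_prop) ?_)
  exact (continuous_subtype_val.comp continuous_snd : Continuous fun z : Circle × Circle => (z.2 : ℂ)).comp_continuousOn h1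

end Cone

/-! ### The two open pieces of the surgered manifold -/

namespace TubularKnot

variable {M : Type*} [TopologicalSpace M] {K : Set M} (N : TubularKnot K)
  (h : (Circle × Circle) ≃ₜ (Circle × Circle))

theorem toFun_mem_iff {x : Circle × ℂ} : N.toFun x ∈ K ↔ x.2 = 0 := by
  rw [(Set.ext_iff.1 N.range_core (N.toFun x)).symm]
  constructor
  · rintro ⟨u, hu⟩
    rw [← N.isOpenEmbedding.injective hu]
  · rintro hx
    exact ⟨x.1, congrArg N.toFun (Prod.ext rfl hx.symm)⟩

theorem toFun_mem_exterior_iff {x : Circle × ℂ} :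
    N.toFun x ∈ (N.toFun '' ((univ : Set Circle) ×ˢ Metric.ball (0 : ℂ) 1))ᶜ ↔ 1 ≤ ‖x.2‖ := by
  rw [mem_compl_iff, N.isOpenEmbedding.injective.mem_set_image]
  simp

theorem toFun_mem_of_one_le {x : Circle × ℂ} (hx : 1 ≤ ‖x.2‖) :
    N.toFun x ∈ (N.toFun '' ((univ : Set Circle) ×ˢ Metric.ball (0 : ℂ) 1))ᶜ :=
  N.toFun_mem_exterior_iff.2 hx

theorem not_mem_of_mem_exterior {x : M}
    (hx : x ∈ (N.toFun '' ((univ : Set Circle) ×ˢ Metric.ball (0 : ℂ) 1))ᶜ) : x ∉ K := by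
  rw [← N.range_core]
  rintro ⟨u, rfl⟩
  exact hx ⟨(u, 0), by simp, rfl⟩

/-- The image of the exterior in the surgered manifold. -/
def ofExterior (x : N.Exterior) : N.Surgery h := Quot.mk _ (Sum.inl x)

/-- The image of the attached solid torus in the surgered manifold. -/
def ofSolidTorus (y : SolidTorus) : N.Surgery h := Quot.mk _ (Sum.inr y)

theorem continuous_ofExterior : Continuous (N.ofExterior h) :=
  continuous_quot_mk.comp continuous_inl

theorem continuous_ofSolidTorus : Continuous (N.ofSolidTorus h) :=
  continuous_quot_mk.comp continuous_inr

variable {h} in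
theorem isOpen_surgery_iff {s : Set (N.Surgery h)} :
    IsOpen s ↔ IsOpen (N.ofExterior h ⁻¹' s) ∧ IsOpen (N.ofSolidTorus h ⁻¹' s) := by
  rw [← isQuotientMap_quot_mk.isOpen_preimage, isOpen_sum_iff]
  rfl

variable {h} in
theorem surgery_cases (x : N.Surgery h) :
    (∃ y, N.ofExterior h y = x) ∨ ∃ y, N.ofSolidTorus h y = x := by
  induction x using Quot.ind with | mk x => ?_
  rcases x with x | x
  · exact Or.inl ⟨x, rfl⟩
  · exact Or.inr ⟨x, rfl⟩

theorem ofExterior_eq_ofSolidTorus (z : Circle × Circle) (x : N.Exterior)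
    (hx : (x : M) = N.toFun ((h z).1, ((h z).2 : ℂ))) (y : SolidTorus) (hy₁ : y.1 = z.1)
    (hy₂ : (y.2 : ℂ) = z.2) : N.ofExterior h x = N.ofSolidTorus h y :=
  Quot.sound ⟨z, hx, hy₁, hy₂⟩

/-- The map from the surgered manifold to the original one which is the inclusion on the exterior and
the radial extension of the gluing map on the solid torus. It is not continuous at the core. -/
def toOriginal : N.Surgery h → M :=
  Quot.lift (Sum.elim (fun x => (x : M)) fun y => N.toFun (torusCone h (y.1, (y.2 : ℂ)))) (by
    rintro (x | x) (y | y) hxy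
    · exact hxy.elim
    · obtain ⟨⟨u, v⟩, hx, hy₁, hy₂⟩ := hxy
      simp only at hy₁ hy₂
      simp [hx, hy₁, hy₂, torusCone_coe]
    · exact hxy.elim
    · exact hxy.elim)

@[simp]
theorem toOriginal_ofExterior (x : N.Exterior) : N.toOriginal h (N.ofExterior h x) = x := rfl

@[simp]
theorem toOriginal_ofSolidTorus (y : SolidTorus) :
    N.toOriginal h (N.ofSolidTorus h y) = N.toFun (torusCone h (y.1, (y.2 : ℂ))) := rfl

/-- The core coordinate of a point of the surgered manifold on the core of the solid torus. -/
def coreCoord : N.Surgery h → Option Circle :=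
  Quot.lift (Sum.elim (fun _ => none) fun y => if (y.2 : ℂ) = 0 then some y.1 else none) (by
    rintro (x | x) (y | y) hxy
    · exact hxy.elim
    · obtain ⟨z, hx, hy₁, hy₂⟩ := hxy
      have hy : (y.2 : ℂ) ≠ 0 := hy₂ ▸ z.2.coe_ne_zero
      exact (if_neg hy).symm
    · exact hxy.elim
    · exact hxy.elim)

open Classical in
/-- A neighbourhood of the attached solid torus, parametrised by the open solid torus. -/
def solidMap (x : Circle × ℂ) : N.Surgery h :=
  if hx : ‖x.2‖ ≤ 1 then N.ofSolidTorus h (x.1, ⟨x.2, by simpa using hx⟩)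
  else N.ofExterior h ⟨N.toFun (torusCone h x), N.toFun_mem_of_one_le (by simpa using le_of_not_ge hx)⟩

theorem solidMap_of_norm_le {x : Circle × ℂ} (hx : ‖x.2‖ ≤ 1) :
    N.solidMap h x = N.ofSolidTorus h (x.1, ⟨x.2, by simpa using hx⟩) := dif_pos hx

/-- On the unit torus both formulas are valid, because the gluing relation identifies their values.
This overlap is what lets continuity be pasted from two closed sets. -/
theorem solidMap_of_one_le {x : Circle × ℂ} (hx : 1 ≤ ‖x.2‖) :
    N.solidMap h x =
      N.ofExterior h ⟨N.toFun (torusCone h x), N.toFun_mem_of_one_le (by simpa using hx)⟩ := by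
  by_cases hx' : ‖x.2‖ ≤ 1
  · rw [N.solidMap_of_norm_le h hx']
    have h1 : ‖x.2‖ = 1 := le_antisymm hx' hx
    have h2 : ((complexDir x.2 : Circle) : ℂ) = x.2 := by
      simpa [h1] using norm_mul_complexDir x.2
    refine (N.ofExterior_eq_ofSolidTorus h (x.1, complexDir x.2) _ ?_ _ rfl h2.symm).symm
    rw [← torusCone_coe, h2]
  · exact dif_neg hx'

@[simp]
theorem toOriginal_solidMap (x : Circle × ℂ) :
    N.toOriginal h (N.solidMap h x) = N.toFun (torusCone h x) := by
  rcases le_total ‖x.2‖ 1 with hx | hx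
  · rw [N.solidMap_of_norm_le h hx]; rfl
  · rw [N.solidMap_of_one_le h hx]; rfl

theorem solidMap_injective : Function.Injective (N.solidMap h) := by
  intro x y hxy
  have h1 : torusCone h x = torusCone h y := by
    apply N.isOpenEmbedding.injective
    rw [← toOriginal_solidMap, ← toOriginal_solidMap, hxy]
  -- `toOriginal` may identify distinct core points, so these are separated by `coreCoord`; off the
  -- core the cone is invertible.
  by_cases hx : x.2 = 0
  · have hy : y.2 = 0 := by
      rwa [← torusCone_snd_eq_zero (f := h), ← h1, torusCone_snd_eq_zero]
    refine Prod.ext ?_ (hx.trans hy.symm)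
    have h2 : ∀ z : Circle × ℂ, z.2 = 0 → N.coreCoord h (N.solidMap h z) = some z.1 := by
      intro z hz
      rw [N.solidMap_of_norm_le h (by simp [hz])]
      exact if_pos hz
    have h3 := h2 y hy
    rw [← hxy, h2 x hx] at h3
    exact Option.some_injective _ h3
  · have hy : y.2 ≠ 0 := by
      rwa [Ne, ← torusCone_snd_eq_zero (f := h), ← h1, torusCone_snd_eq_zero]
    rw [← torusCone_torusCone h.symm_apply_apply hx, h1, torusCone_torusCone h.symm_apply_apply hy]

theorem continuous_solidMap : Continuous (N.solidMap h) := by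
  have h1 : ContinuousOn (N.solidMap h) {x | ‖x.2‖ ≤ 1} := by
    rw [continuousOn_iff_continuous_domRestrict]
    have h2 : {x : Circle × ℂ | ‖x.2‖ ≤ 1}.domRestrict (N.solidMap h) = fun x =>
        N.ofSolidTorus h (x.1.1, ⟨x.1.2, mem_closedBall_zero_iff.2 x.2⟩) :=
      funext fun x => N.solidMap_of_norm_le h x.2
    rw [h2]
    exact (N.continuous_ofSolidTorus h).comp (by fun_prop)
  have h2 : ContinuousOn (N.solidMap h) {x | 1 ≤ ‖x.2‖} := by
    have h3 : {x : Circle × ℂ | 1 ≤ ‖x.2‖}.domRestrict (N.solidMap h) = fun x =>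
        N.ofExterior h ⟨N.toFun (torusCone h x.1), N.toFun_mem_of_one_le
          ((norm_torusCone_snd h x.1).symm ▸ x.2)⟩ :=
      funext fun x => N.solidMap_of_one_le h x.2
    rw [continuousOn_iff_continuous_domRestrict, h3]
    refine (N.continuous_ofExterior h).comp (Continuous.subtype_mk ?_ _)
    refine N.isOpenEmbedding.continuous.comp ?_
    have h4 : ContinuousOn (torusCone h) {x | 1 ≤ ‖x.2‖} :=
      (continuousOn_torusCone h.continuous).mono fun x (hx : 1 ≤ ‖x.2‖) =>
        norm_pos_iff.1 (one_pos.trans_le hx)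
    exact continuousOn_iff_continuous_domRestrict.1 h4
  have h3 := h1.union_of_isClosed h2 (isClosed_le (by fun_prop) (by fun_prop))
    (isClosed_le (by fun_prop) (by fun_prop))
  rw [← continuousOn_univ]
  exact h3.mono fun x _ => le_total ‖x.2‖ 1

instance : Nonempty (Circle × ℂ) := ⟨(1, 0)⟩

/-- The inverse of the parametrisation of the tubular neighbourhood, with junk values outside. -/
def toFunInv : M → Circle × ℂ := (N.isOpenEmbedding.toOpenPartialHomeomorph N.toFun).symm

@[simp]
theorem toFunInv_toFun (x : Circle × ℂ) : N.toFunInv (N.toFun x) = x :=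
  N.isOpenEmbedding.toOpenPartialHomeomorph_left_inv

open Classical in
/-- The map from the complement of the knot to the surgered manifold, with junk values on the knot. -/
def complMap (x : M) : N.Surgery h :=
  if hx : x ∈ (N.toFun '' ((univ : Set Circle) ×ˢ Metric.ball (0 : ℂ) 1))ᶜ then
    N.ofExterior h ⟨x, hx⟩
  else N.solidMap h (torusCone h.symm (N.toFunInv x))

theorem complMap_of_mem {x : M}
    (hx : x ∈ (N.toFun '' ((univ : Set Circle) ×ˢ Metric.ball (0 : ℂ) 1))ᶜ) :
    N.complMap h x = N.ofExterior h ⟨x, hx⟩ := dif_pos hx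

theorem complMap_toFun {x : Circle × ℂ} (hx : x.2 ≠ 0) :
    N.complMap h (N.toFun x) = N.solidMap h (torusCone h.symm x) := by
  by_cases hx' : 1 ≤ ‖x.2‖
  · rw [N.complMap_of_mem h (N.toFun_mem_of_one_le hx'), N.solidMap_of_one_le h (by simpa using hx')]
    congr 2
    rw [torusCone_torusCone h.apply_symm_apply hx]
  · refine (dif_neg ?_).trans ?_
    · rwa [N.toFun_mem_exterior_iff]
    · rw [toFunInv_toFun]

theorem solidMap_eq_complMap {x : Circle × ℂ} (hx : x.2 ≠ 0) :
    N.solidMap h x = N.complMap h (N.toFun (torusCone h x)) := by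
  rw [N.complMap_toFun h (by rwa [Ne, torusCone_snd_eq_zero]),
    torusCone_torusCone h.symm_apply_apply hx]

theorem exists_eq_of_not_mem_exterior {x : M}
    (hx : x ∉ (N.toFun '' ((univ : Set Circle) ×ˢ Metric.ball (0 : ℂ) 1))ᶜ) :
    ∃ y : Circle × ℂ, ‖y.2‖ < 1 ∧ N.toFun y = x := by
  rw [notMem_compl_iff] at hx
  obtain ⟨y, hy, rfl⟩ := hx
  exact ⟨y, by simpa using hy, rfl⟩

theorem toOriginal_complMap {x : M} (hx : x ∉ K) : N.toOriginal h (N.complMap h x) = x := by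
  by_cases hx' : x ∈ (N.toFun '' ((univ : Set Circle) ×ˢ Metric.ball (0 : ℂ) 1))ᶜ
  · rw [N.complMap_of_mem h hx']; rfl
  · obtain ⟨y, -, rfl⟩ := N.exists_eq_of_not_mem_exterior hx'
    have hy : y.2 ≠ 0 := by rwa [Ne, ← N.toFun_mem_iff]
    rw [N.complMap_toFun h hy, toOriginal_solidMap, torusCone_torusCone h.apply_symm_apply hy]

theorem complMap_toOriginal {x : N.Surgery h} (hx : N.toOriginal h x ∉ K) :
    N.complMap h (N.toOriginal h x) = x := by
  rcases N.surgery_cases x with ⟨y, rfl⟩ | ⟨y, rfl⟩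
  · exact N.complMap_of_mem h y.2
  · rw [toOriginal_ofSolidTorus, N.toFun_mem_iff, torusCone_snd_eq_zero] at hx
    rw [toOriginal_ofSolidTorus, ← N.solidMap_eq_complMap h hx,
      N.solidMap_of_norm_le h (mem_closedBall_zero_iff.1 y.2.2)]

/-- Discontinuity of `toOriginal` occurs only on the core, which it sends into `K`. This plays the
role of continuity of the inverse in both open-embedding proofs. -/
theorem isOpen_preimage_toOriginal {V : Set M} (hV : IsOpen V) (hVK : V ⊆ Kᶜ) :
    IsOpen (N.toOriginal h ⁻¹' V) := by
  rw [N.isOpen_surgery_iff]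
  refine ⟨hV.preimage continuous_subtype_val, ?_⟩
  have h1 : ContinuousOn (fun y : SolidTorus => N.toFun (torusCone h (y.1, (y.2 : ℂ))))
      {y | (y.2 : ℂ) ≠ 0} := by
    refine N.isOpenEmbedding.continuous.comp_continuousOn ?_
    exact (continuousOn_torusCone h.continuous).comp (by fun_prop) fun y hy => hy
  have h2 := h1.isOpen_inter_preimage (isOpen_ne_fun (by fun_prop) (by fun_prop)) hV
  convert h2 using 1
  ext y
  simp only [mem_preimage, toOriginal_ofSolidTorus, mem_inter_iff, mem_ofPred_eq]
  refine ⟨fun hy => ⟨fun h0 => hVK hy ?_, hy⟩, fun hy => hy.2⟩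
  rwa [N.toFun_mem_iff, torusCone_snd_eq_zero]

theorem isOpenEmbedding_solidMap : Topology.IsOpenEmbedding (N.solidMap h) := by
  refine .of_continuous_injective_isOpenMap (N.continuous_solidMap h) (N.solidMap_injective h) ?_
  intro W hW
  have h1 : IsOpen (N.solidMap h '' (W ∩ {x | x.2 ≠ 0})) := by
    have h2 : N.solidMap h '' (W ∩ {x | x.2 ≠ 0}) = N.toOriginal h ⁻¹'
        (N.toFun '' ({x | x.2 ≠ 0} ∩ torusCone h.symm ⁻¹' W)) := by
      ext x
      constructor
      · rintro ⟨y, ⟨hyW, hy⟩, rfl⟩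
        refine ⟨torusCone h y, ⟨?_, ?_⟩, (N.toOriginal_solidMap h y).symm⟩
        · rwa [mem_ofPred_eq, Ne, torusCone_snd_eq_zero]
        · rwa [mem_preimage, torusCone_torusCone h.symm_apply_apply hy]
      · rintro ⟨y, ⟨hy, hyW⟩, hyx⟩
        refine ⟨_, ⟨hyW, ?_⟩, ?_⟩
        · rwa [mem_ofPred_eq, Ne, torusCone_snd_eq_zero]
        · rw [← N.complMap_toFun h hy, hyx, N.complMap_toOriginal h]
          rwa [← hyx, N.toFun_mem_iff]
    rw [h2]
    refine N.isOpen_preimage_toOriginal h (N.isOpenEmbedding.isOpenMap _ ?_) ?_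
    · exact (continuousOn_torusCone h.symm.continuous).isOpen_inter_preimage
        (isOpen_ne.preimage continuous_snd) hW
    · rintro _ ⟨y, ⟨hy, -⟩, rfl⟩
      rwa [mem_compl_iff, N.toFun_mem_iff]
  have h2 : IsOpen (N.solidMap h '' (W ∩ {x | ‖x.2‖ < 1})) := by
    rw [N.isOpen_surgery_iff]
    constructor
    · convert isOpen_empty
      ext x
      simp only [mem_preimage, mem_empty_iff_false, iff_false]
      rintro ⟨y, ⟨-, hy⟩, hyx⟩
      have h3 := congrArg (N.toOriginal h) hyx
      rw [toOriginal_solidMap, toOriginal_ofExterior] at h3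
      have h4 := x.2
      rw [← h3, N.toFun_mem_exterior_iff, norm_torusCone_snd] at h4
      exact absurd hy (not_lt.2 h4)
    · have h3 : IsOpen ((fun y : SolidTorus => ((y.1, (y.2 : ℂ)) : Circle × ℂ)) ⁻¹'
          (W ∩ {x | ‖x.2‖ < 1})) :=
        (hW.inter (isOpen_lt (by fun_prop) (by fun_prop))).preimage (by fun_prop)
      convert h3 using 1
      ext y
      have h4 : N.ofSolidTorus h y = N.solidMap h (y.1, (y.2 : ℂ)) :=
        (N.solidMap_of_norm_le h (x := (y.1, (y.2 : ℂ))) (mem_closedBall_zero_iff.1 y.2.2)).symm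
      rw [mem_preimage, h4, (N.solidMap_injective h).mem_set_image]
      rfl
  -- Off the core, openness comes from M - K; inside the unit radius it comes from the attached
  -- solid torus. The two regions overlap and cover.
  have h3 : W = (W ∩ {x | x.2 ≠ 0}) ∪ (W ∩ {x | ‖x.2‖ < 1}) := by
    rw [← inter_union_distrib_left, eq_comm, inter_eq_left]
    intro x _
    by_cases hx : x.2 = 0
    · exact Or.inr (by simp [hx])
    · exact Or.inl hx
  rw [h3, image_union]
  exact h1.union h2

variable [T2Space M]

include N in
theorem isClosed_knot : IsClosed K := by
  rw [← N.range_core]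
  exact (isCompact_range (N.isOpenEmbedding.continuous.comp (by fun_prop))).isClosed

theorem continuousOn_complMap : ContinuousOn (N.complMap h) Kᶜ := by
  intro x hx
  by_cases hxN : x ∈ range N.toFun
  · obtain ⟨y, rfl⟩ := hxN
    have hy : y.2 ≠ 0 := by rwa [mem_compl_iff, N.toFun_mem_iff] at hx
    refine ContinuousAt.continuousWithinAt ?_
    rw [← N.isOpenEmbedding.continuousAt_iff]
    have ho : {x : Circle × ℂ | x.2 ≠ 0} ∈ nhds y :=
      (isOpen_ne.preimage continuous_snd).mem_nhds hy
    have h1 : ContinuousAt (fun x => N.solidMap h (torusCone h.symm x)) y :=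
      (N.continuous_solidMap h).continuousAt.comp
        ((continuousOn_torusCone h.symm.continuous).continuousAt ho)
    refine h1.congr ?_
    filter_upwards [ho] with z hz
    exact (N.complMap_toFun h hz).symm
  -- The compact tube of radius 1 is closed as M is Hausdorff, so near a point outside the chart the
  -- map is just the inclusion of the exterior.
  · have hc : IsClosed (N.toFun '' ((univ : Set Circle) ×ˢ Metric.closedBall (0 : ℂ) 1)) :=
      ((isCompact_univ.prod (isCompact_closedBall _ _)).image
        N.isOpenEmbedding.continuous).isClosed
    have hsub : (N.toFun '' ((univ : Set Circle) ×ˢ Metric.closedBall (0 : ℂ) 1))ᶜ ⊆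
        (N.toFun '' ((univ : Set Circle) ×ˢ Metric.ball (0 : ℂ) 1))ᶜ :=
      compl_subset_compl.2 (image_mono (prod_mono_right Metric.ball_subset_closedBall))
    have h1 : ContinuousOn (N.complMap h)
        (N.toFun '' ((univ : Set Circle) ×ˢ Metric.ball (0 : ℂ) 1))ᶜ := by
      rw [continuousOn_iff_continuous_domRestrict]
      have h2 : (N.toFun '' ((univ : Set Circle) ×ˢ Metric.ball (0 : ℂ) 1))ᶜ.domRestrict
          (N.complMap h) = N.ofExterior h := funext fun x => N.complMap_of_mem h x.2
      rw [h2]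
      exact N.continuous_ofExterior h
    refine (h1.continuousAt ?_).continuousWithinAt
    refine Filter.mem_of_superset (hc.isOpen_compl.mem_nhds fun hx' => hxN ?_) hsub
    exact image_subset_range _ _ hx'

/-- The open embedding of the knot complement into the surgered manifold. -/
def complEmbedding : C(↥Kᶜ, N.Surgery h) where
  toFun x := N.complMap h x
  continuous_toFun := continuousOn_iff_continuous_domRestrict.1 (N.continuousOn_complMap h)

@[simp]
theorem complEmbedding_apply (x : ↥Kᶜ) : N.complEmbedding h x = N.complMap h x := rfl

theorem isOpenEmbedding_complEmbedding : Topology.IsOpenEmbedding (N.complEmbedding h) := by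
  refine .of_continuous_injective_isOpenMap (N.complEmbedding h).continuous ?_ ?_
  · intro x y hxy
    apply Subtype.ext
    rw [← N.toOriginal_complMap h x.2, ← N.toOriginal_complMap h y.2]
    exact congrArg _ hxy
  · intro W hW
    have h1 := N.isOpen_preimage_toOriginal h (N.isClosed_knot.isOpen_compl.isOpenMap_subtype_val W hW)
      (by rintro _ ⟨x, -, rfl⟩; exact x.2)
    convert h1 using 1
    ext x
    constructor
    · rintro ⟨y, hy, rfl⟩
      exact ⟨y, hy, (N.toOriginal_complMap h y.2).symm⟩
    · rintro ⟨y, hy, hyx⟩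
      refine ⟨y, hy, ?_⟩
      rw [complEmbedding_apply, hyx, N.complMap_toOriginal h (hyx ▸ y.2)]

theorem mem_range_complEmbedding_iff {x : N.Surgery h} :
    x ∈ range (N.complEmbedding h) ↔ N.toOriginal h x ∉ K := by
  constructor
  · rintro ⟨y, rfl⟩
    rw [complEmbedding_apply, N.toOriginal_complMap h y.2]
    exact y.2
  · intro hx
    exact ⟨⟨_, hx⟩, N.complMap_toOriginal h hx⟩

theorem solidMap_mem_range_iff {x : Circle × ℂ} :
    N.solidMap h x ∈ range (N.complEmbedding h) ↔ x.2 ≠ 0 := by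
  rw [mem_range_complEmbedding_iff, toOriginal_solidMap, N.toFun_mem_iff, torusCone_snd_eq_zero]

theorem mem_range_complEmbedding_or (x : N.Surgery h) :
    x ∈ range (N.complEmbedding h) ∨ x ∈ range (N.solidMap h) := by
  rcases N.surgery_cases x with ⟨y, rfl⟩ | ⟨y, rfl⟩
  · refine Or.inl ((N.mem_range_complEmbedding_iff h).2 ?_)
    exact N.not_mem_of_mem_exterior y.2
  · exact Or.inr ⟨(y.1, (y.2 : ℂ)), N.solidMap_of_norm_le h (mem_closedBall_zero_iff.1 y.2.2)⟩

end TubularKnot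

/-! ### The surgered space is a closed connected 3-manifold -/

/-- An open embedding of a locally Euclidean space provides charts at the points of its image. -/
theorem Topology.IsOpenEmbedding.exists_chart {A X H : Type*} [TopologicalSpace A]
    [TopologicalSpace X] [TopologicalSpace H] {f : A → X} (hf : Topology.IsOpenEmbedding f) {a : A}
    (e : OpenPartialHomeomorph A H) (he : a ∈ e.source) :
    ∃ e' : OpenPartialHomeomorph X H, f a ∈ e'.source := by
  have : Nonempty A := ⟨a⟩
  refine ⟨(hf.toOpenPartialHomeomorph f).symm.trans e, ?_⟩
  rw [OpenPartialHomeomorph.trans_source]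
  refine ⟨by simp, ?_⟩
  rw [mem_preimage, hf.toOpenPartialHomeomorph_left_inv]
  exact he

theorem nonempty_chartedSpace_of_forall_exists_chart {X H : Type*} [TopologicalSpace X]
    [TopologicalSpace H] (h : ∀ x : X, ∃ e : OpenPartialHomeomorph X H, x ∈ e.source) :
    Nonempty (ChartedSpace H X) := by
  choose e he using h
  exact ⟨{ atlas := univ, chartAt := e, mem_chart_source := he, chart_mem_atlas := fun _ => trivial }⟩

theorem Topology.IsOpenEmbedding.separatedNhds {A X : Type*} [TopologicalSpace A]
    [TopologicalSpace X] [T2Space A] {f : A → X} (hf : Topology.IsOpenEmbedding f) {a b : A}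
    (hab : f a ≠ f b) : SeparatedNhds {f a} {f b} := by
  obtain ⟨u, v, hu, hv, hau, hbv, huv⟩ := t2_separation (fun h => hab (congrArg f h))
  refine ⟨f '' u, f '' v, hf.isOpenMap u hu, hf.isOpenMap v hv, ?_, ?_,
    (disjoint_image_iff hf.injective).2 huv⟩
  · exact singleton_subset_iff.2 (mem_image_of_mem f hau)
  · exact singleton_subset_iff.2 (mem_image_of_mem f hbv)

namespace TubularKnot

variable {M : Type*} [TopologicalSpace M] {K : Set M} (N : TubularKnot K)
  (h : (Circle × Circle) ≃ₜ (Circle × Circle))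

theorem nonempty_chartedSpace_surgery [T2Space M] {H : Type*} [TopologicalSpace H]
    [ChartedSpace H M] : Nonempty (ChartedSpace H (N.Surgery h)) := by
  refine nonempty_chartedSpace_of_forall_exists_chart fun x => ?_
  rcases N.mem_range_complEmbedding_or h x with ⟨y, rfl⟩ | ⟨y, rfl⟩
  · have hK : Topology.IsOpenEmbedding (Subtype.val : ↥Kᶜ → M) :=
      N.isClosed_knot.isOpen_compl.isOpenEmbedding_subtypeVal
    have : Nonempty ↥Kᶜ := ⟨y⟩
    exact (N.isOpenEmbedding_complEmbedding h).exists_chart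
      ((hK.toOpenPartialHomeomorph _).trans (chartAt H (y : M))) (by simp)
  · exact (N.isOpenEmbedding_solidMap h).exists_chart
      ((N.isOpenEmbedding.toOpenPartialHomeomorph _).trans (chartAt H (N.toFun y))) (by simp)

theorem t2Space_surgery [T2Space M] : T2Space (N.Surgery h) := by
  have hj := N.isOpenEmbedding_complEmbedding h
  have hi := N.isOpenEmbedding_solidMap h
  have mixed : ∀ (a : ↥Kᶜ) (b : Circle × ℂ), N.complEmbedding h a ≠ N.solidMap h b →
      SeparatedNhds {N.complEmbedding h a} {N.solidMap h b} := by
    intro a b hab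
    -- Only a core point against a point outside the whole open solid torus is new; the open unit
    -- tube and the complement of the closed one separate them. Otherwise both points lie in one
    -- Hausdorff piece.
    by_cases hb : b.2 = 0
    · by_cases ha : N.complEmbedding h a ∈ range (N.solidMap h)
      · obtain ⟨a', ha'⟩ := ha
        rw [← ha'] at hab ⊢
        exact hi.separatedNhds hab
      · have hc : IsClosed (N.toFun '' ((univ : Set Circle) ×ˢ Metric.closedBall (0 : ℂ) 1)) :=
          ((isCompact_univ.prod (isCompact_closedBall _ _)).image
            N.isOpenEmbedding.continuous).isClosed
        refine ⟨N.complEmbedding h '' (Subtype.val ⁻¹'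
          (N.toFun '' ((univ : Set Circle) ×ˢ Metric.closedBall (0 : ℂ) 1))ᶜ),
          N.solidMap h '' ((univ : Set Circle) ×ˢ Metric.ball (0 : ℂ) 1),
          hj.isOpenMap _ (hc.isOpen_compl.preimage continuous_subtype_val),
          hi.isOpenMap _ (isOpen_univ.prod Metric.isOpen_ball), ?_, ?_, ?_⟩
        · rw [singleton_subset_iff]
          refine mem_image_of_mem _ ?_
          rintro ⟨y, -, hy⟩
          have hy0 : y.2 ≠ 0 := by
            rw [Ne, ← N.toFun_mem_iff, hy]
            exact a.2
          refine ha ⟨_, (N.complMap_toFun h hy0).symm.trans ?_⟩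
          rw [hy]; rfl
        · rw [singleton_subset_iff]
          exact mem_image_of_mem _ (by simp [hb])
        · rw [disjoint_left]
          rintro _ ⟨x, hx, rfl⟩ ⟨y, hy, hyx⟩
          apply hx
          have h1 := congrArg (N.toOriginal h) hyx
          rw [toOriginal_solidMap, complEmbedding_apply, N.toOriginal_complMap h x.2] at h1
          rw [← h1]
          refine mem_image_of_mem _ ⟨trivial, ?_⟩
          rw [mem_closedBall_zero_iff, norm_torusCone_snd]
          exact (mem_ball_zero_iff.1 hy.2).le
    · obtain ⟨b', hb'⟩ := (N.solidMap_mem_range_iff h).2 hb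
      rw [← hb'] at hab ⊢
      exact hj.separatedNhds hab
  refine ⟨fun x y hxy => ?_⟩
  have h1 : SeparatedNhds {x} {y} := by
    rcases N.mem_range_complEmbedding_or h x with ⟨a, rfl⟩ | ⟨a, rfl⟩ <;>
      rcases N.mem_range_complEmbedding_or h y with ⟨b, rfl⟩ | ⟨b, rfl⟩
    · exact hj.separatedNhds hxy
    · exact mixed a b hxy
    · exact (mixed b a hxy.symm).symm
    · exact hi.separatedNhds hxy
  obtain ⟨u, v, hu, hv, hxu, hyv, huv⟩ := h1
  exact ⟨u, v, hu, hv, hxu rfl, hyv rfl, huv⟩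

theorem secondCountableTopology_surgery [T2Space M] [SecondCountableTopology M] :
    SecondCountableTopology (N.Surgery h) := by
  have hj := N.isOpenEmbedding_complEmbedding h
  have hi := N.isOpenEmbedding_solidMap h
  have h1 : ∀ b : Bool, SecondCountableTopology
      ↥(cond b (range (N.complEmbedding h)) (range (N.solidMap h))) := by
    rintro (_ | _)
    · exact hi.isEmbedding.toHomeomorph.symm.isEmbedding.secondCountableTopology
    · exact hj.isEmbedding.toHomeomorph.symm.isEmbedding.secondCountableTopology
  refine TopologicalSpace.secondCountableTopology_of_countable_cover
    (U := fun b : Bool => cond b (range (N.complEmbedding h)) (range (N.solidMap h))) ?_ ?_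
  · rintro (_ | _)
    · exact hi.isOpen_range
    · exact hj.isOpen_range
  · refine eq_univ_of_forall fun x => mem_iUnion.2 ?_
    exact (N.mem_range_complEmbedding_or h x).elim (fun hx => ⟨true, hx⟩) fun hx => ⟨false, hx⟩

theorem compactSpace_surgery [CompactSpace M] : CompactSpace (N.Surgery h) := by
  have h1 : CompactSpace N.Exterior := by
    rw [← isCompact_iff_compactSpace]
    exact (N.isOpenEmbedding.isOpenMap _
      (isOpen_univ.prod Metric.isOpen_ball)).isClosed_compl.isCompact
  have h2 : CompactSpace ↥(Metric.closedBall (0 : ℂ) 1) :=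
    isCompact_iff_compactSpace.1 (isCompact_closedBall _ _)
  infer_instance

theorem connectedSpace_surgery [T2Space M] [ConnectedSpace M] : ConnectedSpace (N.Surgery h) := by
  have hne : Nonempty (N.Surgery h) := ⟨N.solidMap h (1, 0)⟩
  have hpre : PreconnectedSpace (N.Surgery h) := by
    refine preconnectedSpace_of_forall_constant fun f hf => ?_
    have hsolid : ∀ x, f (N.solidMap h x) = f (N.solidMap h (1, 0)) := fun x =>
      PreconnectedSpace.constant inferInstance (hf.comp (N.continuous_solidMap h))
    classical
    -- A two-valued function on the surgered space is transplanted to M by giving it its constant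
    -- solid-torus value on `K`. Connectedness of M then suffices, without that of M - K.
    set g : M → Bool := fun x =>
      if x ∈ K then f (N.solidMap h (1, 0)) else f (N.complMap h x) with hg
    have hgN : ∀ x, g (N.toFun x) = f (N.solidMap h (1, 0)) := by
      intro x
      by_cases hx : N.toFun x ∈ K
      · simp [hg, hx]
      · have hx' : x.2 ≠ 0 := by rwa [N.toFun_mem_iff] at hx
        simp only [hg, hx, if_false]
        rw [N.complMap_toFun h hx', hsolid]
    have hgc : Continuous g := by
      rw [continuous_iff_continuousAt]
      intro x
      by_cases hx : x ∈ range N.toFun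
      · have h1 : ContinuousAt (fun _ : M => f (N.solidMap h (1, 0))) x := continuousAt_const
        refine h1.congr ?_
        filter_upwards [N.isOpenEmbedding.isOpen_range.mem_nhds hx]
        rintro _ ⟨y, rfl⟩
        exact (hgN y).symm
      · have hxK : x ∈ Kᶜ := by
          intro hxK
          rw [← N.range_core] at hxK
          obtain ⟨u, rfl⟩ := hxK
          exact hx (mem_range_self _)
        have hnhds : Kᶜ ∈ nhds x := N.isClosed_knot.isOpen_compl.mem_nhds hxK
        have h1 : ContinuousAt (fun y => f (N.complMap h y)) x :=
          hf.continuousAt.comp ((N.continuousOn_complMap h).continuousAt hnhds)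
        refine h1.congr ?_
        filter_upwards [hnhds] with y hy
        exact (if_neg hy).symm
    have hall : ∀ x, f x = f (N.solidMap h (1, 0)) := by
      intro x
      rcases N.mem_range_complEmbedding_or h x with ⟨y, rfl⟩ | ⟨y, rfl⟩
      · rw [complEmbedding_apply, ← hgN (1, 0),
          PreconnectedSpace.constant (x := N.toFun (1, 0)) (y := y) inferInstance hgc]
        exact (if_neg y.2).symm
      · exact hsolid y
    intro x y
    rw [hall x, hall y]
  exact ⟨hne⟩

/-! ### Fundamental group of the surgered manifold -/

/-- A path in S¹ × ℂ with ends off the core is pushed off it by changing only its ℂ-component: ℂ \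
{0} is path connected and ℂ is simply connected. -/
theorem map_complEmbedding_surjective [T2Space M] (x₀ : ↥Kᶜ) :
    Function.Surjective (FundamentalGroup.map (N.complEmbedding h) x₀) := by
  refine FundamentalGroup.map_surjective_of_isOpenEmbedding (N.complEmbedding h)
    ⟨N.solidMap h, N.continuous_solidMap h⟩ (N.isOpenEmbedding_complEmbedding h)
    (N.isOpenEmbedding_solidMap h) (N.mem_range_complEmbedding_or h)
    ⟨(1, 1), (N.solidMap_mem_range_iff h).2 one_ne_zero⟩ ?_ x₀
  rintro ⟨u, z⟩ ⟨u', z'⟩ hb hb' p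
  have hz : z ≠ 0 := (N.solidMap_mem_range_iff h).1 hb
  have hz' : z' ≠ 0 := (N.solidMap_mem_range_iff h).1 hb'
  have hpc : IsPathConnected ({0}ᶜ : Set ℂ) :=
    isPathConnected_compl_singleton_of_one_lt_rank (by
      rw [Complex.rank_real_complex]; exact Cardinal.one_lt_two) 0
  have hjoin := hpc.joinedIn z hz z' hz'
  let p₁ : Path u u' := p.map continuous_fst
  let p₂ : Path z z' := p.map continuous_snd
  refine ⟨p₁.prod hjoin.somePath, fun t => ?_, ?_⟩
  · exact (N.solidMap_mem_range_iff h).2 (hjoin.somePath_mem t)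
  · have h1 : p = p₁.prod p₂ := by
      ext t <;> rfl
    rw [h1]
    exact ⟨Path.Homotopic.prodHomotopy (.refl _)
      (SimplyConnectedSpace.paths_homotopic p₂ hjoin.somePath).some⟩

/-- The homomorphism from the fundamental group of the peripheral torus to the knot group given by
the path `γ` to the base point. -/
def peripheralHom {x₀ : ↥Kᶜ} (γ : Path x₀ (N.torus (1, 1))) :
    FundamentalGroup (Circle × Circle) 1 →* FundamentalGroup (↥Kᶜ) x₀ :=
  (FundamentalGroup.fundamentalGroupMulEquivOfPath γ.symm).toMonoidHom.comp
    (FundamentalGroup.map N.torus 1)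

theorem peripheralHom_mk {x₀ : ↥Kᶜ} (γ : Path x₀ (N.torus (1, 1)))
    (p : Path (1 : Circle × Circle) 1) : N.peripheralHom γ (FundamentalGroup.fromPath (.mk p)) =
      FundamentalGroup.fromPath (.mk (γ.trans ((p.map N.torus.continuous).trans γ.symm))) := by
  rw [peripheralHom, MonoidHom.comp_apply]
  change (Path.Homotopic.Quotient.mk γ.symm).symm.trans
    ((Path.Homotopic.Quotient.mk (p.map N.torus.continuous)).trans
      (Path.Homotopic.Quotient.mk γ.symm)) = _
  rw [← Path.Homotopic.Quotient.mk_symm, Path.symm_symm]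
  rfl

theorem map_peripheralHom_eq_one {Y : Type*} [TopologicalSpace Y] {x₀ : ↥Kᶜ}
    (γ : Path x₀ (N.torus (1, 1))) (j : C(↥Kᶜ, Y))
    {α : FundamentalGroup (Circle × Circle) 1}
    (hα : FundamentalGroup.map (j.comp N.torus) 1 α = 1) :
    FundamentalGroup.map j x₀ (N.peripheralHom γ α) = 1 := by
  have key : ∀ q : Path (N.torus (1, 1)) (N.torus (1, 1)),
      Path.Homotopic.Quotient.mk (q.map j.continuous) = Path.Homotopic.Quotient.refl _ →
        Path.Homotopic.Quotient.mk ((γ.trans (q.trans γ.symm)).map j.continuous) =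
          Path.Homotopic.Quotient.refl _ := by
    intro q hq
    rw [Path.map_trans, Path.map_trans, Path.Homotopic.Quotient.mk_trans,
      Path.Homotopic.Quotient.mk_trans, hq, ← Path.map_symm, Path.Homotopic.Quotient.mk_symm,
      Path.Homotopic.Quotient.refl_trans, Path.Homotopic.Quotient.trans_symm]
  induction α using Path.Homotopic.Quotient.ind with | mk p => ?_
  rw [N.peripheralHom_mk γ p]
  exact key _ hα

/-- The inclusion of the second factor of the torus, as a pointed map. -/
def meridianMap : pointedMaps Circle 1 (Circle × Circle) := ⟨⟨fun v => (1, v), by fun_prop⟩, rfl⟩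

/-- The inclusion of the first factor of the torus, as a pointed map. -/
def longitudeMap : pointedMaps Circle 1 (Circle × Circle) := ⟨⟨fun v => (v, 1), by fun_prop⟩, rfl⟩

theorem meridian_eq {x₀ : ↥Kᶜ} (γ : Path x₀ (N.torus (1, 1))) :
    N.meridian γ = N.peripheralHom γ (loopClass circleLoop meridianMap) :=
  (N.peripheralHom_mk γ _).symm

theorem longitude_eq {x₀ : ↥Kᶜ} (γ : Path x₀ (N.torus (1, 1))) :
    N.longitude γ = N.peripheralHom γ (loopClass circleLoop longitudeMap) :=
  (N.peripheralHom_mk γ _).symm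

/-- Both classes are images of pointed maps into the abelian group S¹ × S¹, and those maps commute
under pointwise multiplication. -/
theorem commute_meridian_longitude {x₀ : ↥Kᶜ} (γ : Path x₀ (N.torus (1, 1))) :
    Commute (N.meridian γ) (N.longitude γ) := by
  rw [meridian_eq, longitude_eq]
  exact ((Commute.all _ _).map (loopClass circleLoop)).map (N.peripheralHom γ)

theorem complEmbedding_torus_apply [T2Space M] (z : Circle × Circle) :
    N.complEmbedding h (N.torus (h z)) = N.solidMap h (z.1, (z.2 : ℂ)) := by
  rw [N.solidMap_eq_complMap h z.2.coe_ne_zero, torusCone_coe]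
  rfl

/-- The class is that of the loop v ↦ (v^q, v^p), which is freely homotopic to v ↦ h (1, v) and so
bounds a meridian disk of the new solid torus. -/
theorem meridian_zpow_mul_longitude_zpow [T2Space M] {x₀ : ↥Kᶜ} (γ : Path x₀ (N.torus (1, 1)))
    {p q : ℤ} (hh : HasSlope h p q) :
    FundamentalGroup.map (N.complEmbedding h) x₀ (N.meridian γ ^ p * N.longitude γ ^ q) = 1 := by
  set f := meridianMap ^ p * longitudeMap ^ q with hf
  have h1 : N.meridian γ ^ p * N.longitude γ ^ q =
      N.peripheralHom γ (loopClass circleLoop f) := by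
    rw [hf, map_mul, map_mul, map_zpow, map_zpow, map_zpow, map_zpow, ← meridian_eq,
      ← longitude_eq]
  have hfv : f.1 = ⟨fun v => (v ^ q, v ^ p), (continuous_zpow q).prodMk (continuous_zpow p)⟩ := by
    ext v <;> simp [hf, meridianMap, longitudeMap]
  set jt : C(Circle × Circle, N.Surgery h) := (N.complEmbedding h).comp N.torus
  have h2 : (jt.comp f.1).Homotopic
      (ContinuousMap.const Circle (N.solidMap h (1, 0))) := by
    have h3 : (jt.comp ⟨fun v => h (1, v), by fun_prop⟩).Homotopic (jt.comp f.1) := by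
      rw [hfv]
      exact ContinuousMap.Homotopic.comp (.refl jt) hh
    -- The boundary of the disk {1} × D² is contracted radially to its centre.
    refine h3.symm.trans ⟨⟨⟨fun x => N.solidMap h (1, ((1 - (x.1 : ℝ) : ℝ) : ℂ) * (x.2 : ℂ)),
      (N.continuous_solidMap h).comp (by fun_prop)⟩, fun v => ?_, fun v => ?_⟩⟩
    · refine Eq.trans ?_ (N.complEmbedding_torus_apply h (1, v)).symm
      simp
    · simp
  have h4 := mk_map_eq_refl_of_homotopic_const h2 circleLoop
  rw [h1]
  exact N.map_peripheralHom_eq_one γ _ (map_loopClass_eq_one jt h4)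

end TubularKnot

theorem theorem1 {M : Type*} [TopologicalSpace M] [ConnectedSpace M]
    (hM : IsClosedThreeManifold M) (K : Set M) (N : TubularKnot K)
    (x₀ : ↥Kᶜ) (γ : Path x₀ (N.torus (1, 1)))
    (w₁ w₂ : FreeGroup (Fin 2)) (m n k : ℕ) (r : ℤ) (hmn : m ≠ 0 ∨ n ≠ 0)
    (e : PresentedGroup {gbsRelator w₁ w₂ m n k r} ≃* FundamentalGroup (↥Kᶜ) x₀)
    (s t : ℤ) (w : List (Fin 2)) (hw : 1 ∈ w)
    (hmeridian : e (PresentedGroup.mk _ (FreeGroup.of 0)) = N.meridian γ)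
    (hlongitude : e (PresentedGroup.mk _
      (FreeGroup.of 0 ^ (-s) * positiveWord w * FreeGroup.of 0 ^ (-t))) = N.longitude γ)
    (p q : ℤ) (hpq : IsCoprime p q) (hq : q ≠ 0) (hslope : (s : ℚ) + t ≤ p / q)
    (h : (Circle × Circle) ≃ₜ (Circle × Circle)) (hh : HasSlope h p q) :
    IsClosedThreeManifold (N.Surgery h) ∧ ConnectedSpace (N.Surgery h) ∧
      ∀ x : N.Surgery h, ¬ IsLeftOrderable (FundamentalGroup (N.Surgery h) x) := by
  obtain ⟨hT2, hSC, hC, ⟨hcs⟩⟩ := hM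
  have hconn := N.connectedSpace_surgery h
  have hchart := N.nonempty_chartedSpace_surgery h (H := EuclideanSpace ℝ (Fin 3))
  refine ⟨⟨N.t2Space_surgery h, N.secondCountableTopology_surgery h, N.compactSpace_surgery h,
    hchart⟩, hconn, fun x => ?_⟩
  obtain ⟨hcs'⟩ := hchart
  have : LocallyPathConnectedSpace (N.Surgery h) :=
    ChartedSpace.locallyPathConnectedSpace (EuclideanSpace ℝ (Fin 3)) _
  have : PathConnectedSpace (N.Surgery h) := pathConnectedSpace_iff_connectedSpace.2 hconn
  -- The base point x is arbitrary, so the induced map is followed by a change of base point,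
  -- available because a connected manifold is path connected.
  let φ : FundamentalGroup (↥Kᶜ) x₀ →* FundamentalGroup (N.Surgery h) x :=
    (FundamentalGroup.fundamentalGroupMulEquivOfPathConnected
      (N.complEmbedding h x₀) x).toMonoidHom.comp (FundamentalGroup.map (N.complEmbedding h) x₀)
  refine not_isLeftOrderable_of_presentation (φ := φ) hmn e hw hmeridian hlongitude
    (N.commute_meridian_longitude γ) hpq hq hslope ?_ ?_
  · exact (MulEquiv.surjective (FundamentalGroup.fundamentalGroupMulEquivOfPathConnected
      (N.complEmbedding h x₀) x)).comp (N.map_complEmbedding_surjective h x₀)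
  · rw [MonoidHom.comp_apply, N.meridian_zpow_mul_longitude_zpow h γ hh, map_one]

end
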